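/- Let $\mathfrak g$ be a finite-dimensional real Lie algebra with negative definite Killing form, and let $B$ be the negative of its Killing form. A *generalized Wallach decomposition* of $\mathfrak g$ is a $B$-orthogonal decomposition $\mathfrak g=\mathfrak k\oplus\mathfrak m_1\oplus\mathfrak m_2\oplus\mathfrak m_3$, where $\mathfrak k$ is a subalgebra, each $\mathfrak m_i$ is a (nonzero) irreducible $\mathrm{ad}(\mathfrak k)$-module, $[\mathfrak m_i,\mathfrak m_i]\subset\mathfrak k$ for all $i$, and $[\mathfrak m_i,\mathfrak m_j]\subset\mathfrak m_k$ whenever $\{i,j,k\}=\{1,2,3\}$. Suppose that $\mathfrak k=\mathfrak k_1\oplus\mathfrak k_2$ with simple ideals $\mathfrak k_1,\mathfrak k_2$. The decomposition is said to be of type * $\mathrm E_6$-III if $\mathfrak g$ is the compact Lie algebra of type $E_6$, $\mathfrak k_1\cong A_1$, $\mathfrak k_2\cong C_3$, and the $\mathfrak m_i$ are numbered so that $\mathfrak k_2\oplus\mathfrak m_1$ is a subalgebra isomorphic to $A_5$ and $\mathfrak k\oplus\mathfrak m_2$ is a subalgebra isomorphic to $F_4$; * $\mathrm E_8$-II if $\mathfrak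 g$ is the compact Lie algebra of type $E_8$, $\mathfrak k_1\cong\mathfrak k_2\cong D_4$, and $\mathfrak k\oplus\mathfrak m_1$ and $\mathfrak k\oplus\mathfrak m_2$ are subalgebras isomorphic to $D_8$ (here $A_n,C_n,D_n,F_4$ denote the compact real Lie algebras of these types). Put $\mathfrak k_3=\mathfrak m_1$, $\mathfrak k_4=\mathfrak m_2$, $\mathfrak k_5=\mathfrak m_3$, let $\{e^i_\alpha\}_\alpha$ be any $B$-orthonormal basis of $\mathfrak k_i$ ($1\le i\le 5$), and set $$(ijl)=\sum_{\alpha,\beta,\gamma}B\big([e^i_\alpha,e^j_\beta],e^l_\gamma\big)^2 .$$ In both cases $(ijl)$ is symmetric in its three indices, and $(ijl)=0$ unless $(i,j,l)$ is, up to order, one of $(1,1,1),(2,2,2),(1,3,3),(1,4,4),(1,5,5),(2,3,3),(2,4,4),(2,5,5),(3,4,5)$. Moreover: * for type $\mathrm E_6$-III: $(111)=\frac12$, $(133)=0$, $(144)=\frac74$, $(155)=\frac34$, $(222)=7$, $(233)=\frac72$, $(244)=\frac{35}4$, $(255)=\frac74$, $(345)=\frac72$; * for type $\mathrm E_8$-II: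 $(111)=(222)=\frac{28}5$, $(345)=\frac{256}{15}$, and $(133)=(144)=(155)=(233)=(244)=(255)=\frac{112}{15}$. -/

import Mathlib

open scoped TensorProduct

/-- The negative `B` of the Killing form of a real Lie algebra. -/
noncomputable def negKilling (g : Type*) [LieRing g] [LieAlgebra ℝ g] : LinearMap.BilinForm ℝ g :=
  -killingForm ℝ g

/-- `L` is the compact real Lie algebra whose type is given by the Cartan matrix `A`: its Killing
form is negative definite, and its complexification is a semisimple complex Lie algebra whose root
system (for some Cartan subalgebra and some base) has Cartan matrix `A`, up to relabelling. -/
def IsCompactOfType {ι : Type*} (A : Matrix ι ι ℤ) (L : Type*) [LieRing L] [LieAlgebra ℝ L]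
    [FiniteDimensional ℝ L] : Prop :=
  (∀ x : L, x ≠ 0 → 0 < negKilling L x x) ∧
  ∃ (_ : LieAlgebra.IsKilling ℂ (ℂ ⊗[ℝ] L)) (H : LieSubalgebra ℂ (ℂ ⊗[ℝ] L))
    (_ : H.IsCartanSubalgebra) (b : (LieAlgebra.IsKilling.rootSystem H).Base)
    (e : b.support ≃ ι), Matrix.reindex e e b.cartanMatrix = A

section

variable {g : Type*} [LieRing g] [LieAlgebra ℝ g]

/-- `m` is a nonzero irreducible `ad(k)`-invariant subspace of `g`. -/
structure IsAdIrreducible (k : LieSubalgebra ℝ g) (m : Submodule ℝ g) : Prop where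
  invariant : ∀ x ∈ k, ∀ y ∈ m, ⁅x, y⁆ ∈ m
  ne_bot : m ≠ ⊥
  eq_bot_or_eq : ∀ W : Submodule ℝ g, W ≤ m → (∀ x ∈ k, ∀ y ∈ W, ⁅x, y⁆ ∈ W) → W = ⊥ ∨ W = m

/-- The decomposition `g = k ⊕ m 0 ⊕ m 1 ⊕ m 2` of a generalized Wallach space `G/K`. (For definite
`B`, directness of the sum follows from orthogonality.) -/
structure IsGeneralizedWallach (k : LieSubalgebra ℝ g) (m : Fin 3 → Submodule ℝ g) : Prop where
  sup_eq_top : k.toSubmodule ⊔ ⨆ i, m i = ⊤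
  orthogonal_k : ∀ i, ∀ x ∈ k, ∀ y ∈ m i, negKilling g x y = 0
  orthogonal : ∀ i j, i ≠ j → ∀ x ∈ m i, ∀ y ∈ m j, negKilling g x y = 0
  irreducible : ∀ i, IsAdIrreducible k (m i)
  lie_self : ∀ i, ∀ x ∈ m i, ∀ y ∈ m i, ⁅x, y⁆ ∈ k
  lie_ne : ∀ i j l, i ≠ j → j ≠ l → i ≠ l → ∀ x ∈ m i, ∀ y ∈ m j, ⁅x, y⁆ ∈ m l

/-- `k = k₁ ⊕ k₂` is the direct sum of the two commuting subalgebras (hence ideals) `k₁`, `k₂`. -/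
structure IsSumOfIdeals (k k₁ k₂ : LieSubalgebra ℝ g) : Prop where
  sup_eq : k₁.toSubmodule ⊔ k₂.toSubmodule = k.toSubmodule
  disjoint : Disjoint k₁.toSubmodule k₂.toSubmodule
  lie_eq_zero : ∀ x ∈ k₁, ∀ y ∈ k₂, ⁅x, y⁆ = 0

/-- The subspace `V` of `g` is a subalgebra, and as such a compact Lie algebra of type `A`. -/
def IsCompactSubalgebraOfType [FiniteDimensional ℝ g] {ι : Type*} (A : Matrix ι ι ℤ)
    (V : Submodule ℝ g) : Prop :=
  ∃ b : LieSubalgebra ℝ g, b.toSubmodule = V ∧ IsCompactOfType A b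

/-- The decomposition `E₆`-III: `g` is compact of type `E₆`, `k = k₁ ⊕ k₂ = A₁ ⊕ C₃`, and
`g = k ⊕ m₁ ⊕ m₂ ⊕ m₃` is a generalized Wallach decomposition, in which the modules are numbered by
the symmetric subalgebras `A₁ ⊕ A₅` and `F₄` belonging to the two commuting involutions:
`k₂ ⊕ m₁ ≅ A₅` and `k ⊕ m₂ ≅ F₄`. -/
structure IsE6III [FiniteDimensional ℝ g] (k k₁ k₂ : LieSubalgebra ℝ g)
    (m₁ m₂ m₃ : Submodule ℝ g) : Prop where
  type_g : IsCompactOfType CartanMatrix.E₆ g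
  wallach : IsGeneralizedWallach k ![m₁, m₂, m₃]
  ideals : IsSumOfIdeals k k₁ k₂
  type_k₁ : IsCompactOfType (CartanMatrix.A 1) k₁
  type_k₂ : IsCompactOfType (CartanMatrix.C 3) k₂
  type_A₅ : IsCompactSubalgebraOfType (CartanMatrix.A 5) (k₂.toSubmodule ⊔ m₁)
  type_F₄ : IsCompactSubalgebraOfType CartanMatrix.F₄ (k.toSubmodule ⊔ m₂)

/-- The decomposition `E₈`-II: `g` is compact of type `E₈`, `k = k₁ ⊕ k₂ = D₄ ⊕ D₄`, and
`g = k ⊕ m₁ ⊕ m₂ ⊕ m₃` is a generalized Wallach decomposition, whose two commuting involutions have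
the symmetric subalgebras `k ⊕ m₁ ≅ D₈` and `k ⊕ m₂ ≅ D₈`. -/
structure IsE8II [FiniteDimensional ℝ g] (k k₁ k₂ : LieSubalgebra ℝ g)
    (m₁ m₂ m₃ : Submodule ℝ g) : Prop where
  type_g : IsCompactOfType CartanMatrix.E₈ g
  wallach : IsGeneralizedWallach k ![m₁, m₂, m₃]
  ideals : IsSumOfIdeals k k₁ k₂
  type_k₁ : IsCompactOfType (CartanMatrix.D 4) k₁
  type_k₂ : IsCompactOfType (CartanMatrix.D 4) k₂
  type_D₈ : IsCompactSubalgebraOfType (CartanMatrix.D 8) (k.toSubmodule ⊔ m₁)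
  type_D₈' : IsCompactSubalgebraOfType (CartanMatrix.D 8) (k.toSubmodule ⊔ m₂)

end

/-- The indices `1, 2, 3, 4, 5` of the summands of `g = k₁ ⊕ k₂ ⊕ m₁ ⊕ m₂ ⊕ m₃`. -/
inductive Idx : Type
  | i1 | i2 | i3 | i4 | i5

section

variable {g : Type*} [LieRing g] [LieAlgebra ℝ g]

/-- The summands of `g`, in the order `k₁, k₂, m₁, m₂, m₃`. -/
def summand (k₁ k₂ : LieSubalgebra ℝ g) (m₁ m₂ m₃ : Submodule ℝ g) : Idx → Submodule ℝ g
  | .i1 => k₁.toSubmodule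
  | .i2 => k₂.toSubmodule
  | .i3 => m₁
  | .i4 => m₂
  | .i5 => m₃

/-- Each of the given bases of the subspaces `V i` is `B`-orthonormal. -/
def IsAdaptedOrthonormal {V : Idx → Submodule ℝ g} {d : Idx → ℕ}
    (e : ∀ i, Module.Basis (Fin (d i)) ℝ (V i)) : Prop :=
  ∀ i, ∀ a b : Fin (d i), negKilling g (e i a : g) (e i b : g) = if a = b then 1 else 0

/-- The number `(i j l) = ∑_{α, β, γ} B([e^i_α, e^j_β], e^l_γ)²`. -/
noncomputable def triple {V : Idx → Submodule ℝ g} {d : Idx → ℕ}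
    (e : ∀ i, Module.Basis (Fin (d i)) ℝ (V i)) (i j l : Idx) : ℝ :=
  ∑ a : Fin (d i), ∑ b : Fin (d j), ∑ c : Fin (d l),
    (negKilling g ⁅(e i a : g), (e j b : g)⁆ (e l c : g)) ^ 2

end

open Idx

/-- The index triples (up to order) whose numbers `(i j l)` may be nonzero. -/
def listedTriples : Set (Multiset Idx) :=
  {{i1, i1, i1}, {i2, i2, i2}, {i1, i3, i3}, {i1, i4, i4}, {i1, i5, i5},
   {i2, i3, i3}, {i2, i4, i4}, {i2, i5, i5}, {i3, i4, i5}}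

/-!
Write `B` for the negative of the Killing form. The numbers `(i j l)` are determined by linear
relations whose coefficients are the dimensions of the summands.

* The bracket relations and orthogonality make `(i j l)` symmetric and zero for all index triples
  not listed (`notMem_bracketIndices_of_notMem_listedTriples`). Here `k₁ ⊥ k₂` because an invariant
  form vanishes between commuting subalgebras one of which has no center (`eq_zero_of_commute`).
* For an orthonormal family `u` that spans a subalgebra `q`, the form `traceForm u` is the negative
  of the Killing form of `q`, written as a sum over `u`. For `q = g` it is `B`, hence
  `∑ j l, (i j l) = d i`.
* For `q = k ⊕ mᵢ` it is an invariant form on `q`. On the irreducible module `mᵢ` it is a multiple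
  `c • B` (`IsAdIrreducible.exists_eq_mul`), on each simple ideal `kₛ` it is a multiple of `B` too
  (`IsCompactOfType.exists_eq_mul`), and invariance forces the factors to agree unless
  `[kₛ, mᵢ] = 0`. This gives `2 (1ii) + 2 (2ii) = c * d i`, and `(sss) + (sii) = c * d s` unless
  `(sii) = 0`; both `(sii)` cannot vanish unless `d i = 1`. All this is `tripleRelations`.
* In type `E₆`-III, `(133) = 0` because `[m₁, m₁] ⊆ k₂` (`triple_one_three_three_eq_zero`).

Given the dimensions, the degenerate alternatives contradict `(i j l) ≥ 0`, and the remaining linear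
system has one solution (`TripleRelations.eq_of_dim_E6`, `TripleRelations.eq_of_dim_E8`).

The Cartan matrices enter in two ways. A compact Lie algebra of rank `n` has dimension `n` plus the
number of its roots (`IsCompactOfType.finrank_eq`), and the positive roots are counted by growing
their coordinate vectors from the simple roots by height-increasing simple reflections
(`RootCount.natCard_eq_of_hasPositiveRoots`). And if the Dynkin diagram is connected, the only
endomorphisms that commute with the adjoint action are the scalars
(`IsCompactOfType.exists_forall_eq_smul`): on the complexification such a map acts by a scalar on
each root space and its coroot, and the scalars of adjacent simple roots agree.
-/

/-! ### Counting the roots of a root system from its Cartan matrix -/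

namespace RootCount

/-- The dot product of two integer vectors, stored as lists. -/
def dot : List ℤ → List ℤ → ℤ
  | a :: l, b :: m => a * b + dot l m
  | _, _ => 0

/-- The columns of a Cartan matrix: the `j`-th one lists the values of the `j`-th simple coroot on
the simple roots. -/
def columns {n : ℕ} (A : Matrix (Fin n) (Fin n) ℤ) : List (List ℤ) :=
  List.ofFn fun j => List.ofFn fun i => A i j

/-- The coordinate vectors of the simple roots. -/
def simples (n : ℕ) : List (List ℤ) :=
  List.ofFn fun j : Fin n => List.ofFn fun i : Fin n => if i = j then 1 else 0

/-- The `j`-th simple reflection in coordinates with respect to the simple roots; `cols` are the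
columns of the Cartan matrix. -/
def reflect (cols : List (List ℤ)) (j : ℕ) (v : List ℤ) : List ℤ :=
  v.set j (v.getD j 0 - dot v (cols.getD j []))

/-- All vectors obtained from a vector of `F` by a simple reflection that increases its height. -/
def raise (cols : List (List ℤ)) (F : List (List ℤ)) : List (List ℤ) :=
  (F.flatMap fun v => ((List.range cols.length).filter fun j => dot v (cols.getD j []) < 0).map
    fun j => reflect cols j v).dedup

/-- The first `h` layers of vectors, each obtained by `raise` from the one before, starting with
`F`. -/
def levels (cols : List (List ℤ)) : ℕ → List (List ℤ) → List (List ℤ)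
  | 0, _ => []
  | h + 1, F => F ++ levels cols h (raise cols F)

/-- The layers of coordinate vectors that grow from the simple roots under height-increasing simple
reflections stop before the layer `h`, and consist of `N` distinct vectors of positive height. If
`A` is the Cartan matrix of a root system, these are the coordinates of its positive roots. -/
def HasPositiveRoots {n : ℕ} (A : Matrix (Fin n) (Fin n) ℤ) (h N : ℕ) : Prop :=
  (raise (columns A))^[h] (simples n) = [] ∧
    (levels (columns A) h (simples n)).length = N ∧
    (levels (columns A) h (simples n)).Nodup ∧
    ∀ v ∈ levels (columns A) h (simples n), 0 < v.sum

instance {n : ℕ} (A : Matrix (Fin n) (Fin n) ℤ) (h N : ℕ) : Decidable (HasPositiveRoots A h N) := by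
  unfold HasPositiveRoots; infer_instance

lemma dot_ofFn {n : ℕ} (f : Fin n → ℤ) (v : List ℤ) :
    dot v (List.ofFn f) = ∑ i : Fin n, v.getD i 0 * f i := by
  induction n generalizing v with
  | zero => cases v <;> simp [dot]
  | succ n ih => cases v <;> simp [dot, Fin.sum_univ_succ, ih]

lemma forall_mem_levels {cols : List (List ℤ)} {p : List ℤ → Prop}
    (hp : ∀ v, ∀ j < cols.length, p v → p (reflect cols j v)) (h : ℕ) (F : List (List ℤ))
    (hF : ∀ v ∈ F, p v) : ∀ v ∈ levels cols h F, p v := by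
  induction h generalizing F with
  | zero => simp [levels]
  | succ h ih =>
    intro v hv
    rcases List.mem_append.1 hv with hv | hv
    · exact hF v hv
    · refine ih _ (fun w hw => ?_) v hv
      simp only [raise, List.mem_dedup, List.mem_flatMap, List.mem_map, List.mem_filter,
        List.mem_range] at hw
      obtain ⟨u, hu, j, ⟨hj, -⟩, rfl⟩ := hw
      exact hp u j hj (hF u hu)

lemma mem_levels_of_mem {cols F : List (List ℤ)} {h : ℕ} (hF : (raise cols)^[h] F = [])
    {v : List ℤ} (hv : v ∈ F) : v ∈ levels cols h F := by
  cases h with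
  | zero => simp_all
  | succ h => exact List.mem_append_left _ hv

lemma reflect_mem_levels {cols F : List (List ℤ)} {h : ℕ} (hF : (raise cols)^[h] F = [])
    {v : List ℤ} (hv : v ∈ levels cols h F) {j : ℕ} (hj : j < cols.length)
    (hd : dot v (cols.getD j []) < 0) : reflect cols j v ∈ levels cols h F := by
  induction h generalizing F with
  | zero => simp [levels] at hv
  | succ h ih =>
    refine List.mem_append_right _ ?_
    rcases List.mem_append.1 hv with hv | hv
    · refine mem_levels_of_mem (F := raise cols F) hF ?_
      simp only [raise, List.mem_dedup, List.mem_flatMap, List.mem_map, List.mem_filter,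
        List.mem_range]
      exact ⟨v, hv, j, ⟨hj, by simpa using hd⟩, rfl⟩
    · exact ih hF hv

section

variable {ι K M N : Type*} [Field K] [AddCommGroup M] [Module K M] [AddCommGroup N]
  [Module K N] {P : RootPairing ι K M N} {b : P.Base}
  {n : ℕ} (e : b.support ≃ Fin n)

/-- The vector with the given coordinates with respect to the simple roots. -/
def combination (v : List ℤ) : M :=
  ∑ i : Fin n, (v.getD i 0 : ℤ) • P.root (e.symm i : ι)

lemma combination_injOn [CharZero K] : Set.InjOn (combination e) {v | v.length = n} := by
  intro v hv w hw h
  have hli : LinearIndependent ℤ (fun i : Fin n => P.root (e.symm i : ι)) :=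
    (b.linearIndepOn_root.restrict_scalars' ℤ).comp _ e.symm.injective
  have := Fintype.linearIndependent_iffₛ.mp hli (fun i => v.getD i 0) (fun i => w.getD i 0) h
  refine List.ext_getElem (hv.trans hw.symm) fun i hi hi' => ?_
  simpa [hi, hi'] using this ⟨i, hv ▸ hi⟩

lemma combination_simple (j : Fin n) :
    combination e ((simples n).getD j []) = P.root (e.symm j : ι) := by
  simp [combination, simples, ite_smul]

variable [P.IsCrystallographic] {A : Matrix (Fin n) (Fin n) ℤ}
  (hA : Matrix.reindex e e b.cartanMatrix = A)
include hA

lemma combination_reflect {v : List ℤ} (hv : v.length = n) (j : Fin n) :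
    combination e (reflect (columns A) j v) = P.reflection (e.symm j) (combination e v) ∧
      P.reflection (e.symm j) (combination e v) = combination e v -
        dot v ((columns A).getD j []) • P.root (e.symm j : ι) := by
  have h1 : dot v ((columns A).getD j []) = ∑ i : Fin n, v.getD i 0 * A i j := by
    rw [← dot_ofFn]; simp [columns]
  have h2 : P.reflection (e.symm j) (combination e v) = combination e v -
      dot v ((columns A).getD j []) • P.root (e.symm j : ι) := by
    have h3 (i : Fin n) : P.reflection (e.symm j) (P.root (e.symm i : ι)) =
        P.root (e.symm i : ι) - A i j • P.root (e.symm j : ι) := by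
      rw [P.reflection_apply_root' ℤ, ← hA]; rfl
    simp only [combination, map_sum, map_zsmul, h3, h1, smul_sub, Finset.sum_sub_distrib,
      Finset.sum_smul, mul_smul]
  refine ⟨?_, h2⟩
  rw [h2]
  have h4 (i : Fin n) : (reflect (columns A) j v).getD i 0 =
      v.getD i 0 - if i = j then dot v ((columns A).getD j []) else 0 := by
    have hi : (i : ℕ) < v.length := hv ▸ i.2
    simp only [reflect, List.getD_eq_getElem?_getD, List.getElem?_set]
    by_cases hij : i = j
    · subst hij; simp [hi]
    · have : (j : ℕ) ≠ i := fun h => hij (Fin.ext h.symm)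
      simp [hij, this]
  simp only [combination, h4, sub_smul, ite_smul, zero_smul, Finset.sum_sub_distrib,
    Finset.sum_ite_eq', Finset.mem_univ, if_true]

/-- Every positive root occurs in the layers: a positive root that is not simple is moved to one of
smaller height by some simple reflection, and comes back by a height-increasing one. -/
lemma exists_mem_levels_of_isPos [CharZero K] [Finite ι] [P.IsRootSystem] [P.IsReduced] {h : ℕ}
    (hF : (raise (columns A))^[h] (simples n) = []) {i : ι} (hi : b.IsPos i) :
    ∃ v ∈ levels (columns A) h (simples n), v.length = n ∧ P.root i = combination e v := by
  induction hm : (b.height i).toNat using Nat.strong_induction_on generalizing i with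
  | _ m ih =>
  obtain ⟨j, hj, hji⟩ := hi.exists_mem_support_pos_pairingIn
  rw [P.zero_lt_pairingIn_iff'] at hji
  rcases eq_or_ne i j with rfl | hij
  · refine ⟨(simples n).getD (e ⟨i, hj⟩) [], mem_levels_of_mem hF ?_, ?_, ?_⟩
    · simp [simples]
    · simp [simples]
    · rw [combination_simple]; simp
  have hk := hi.reflectionPerm hj hij
  have hroot : P.root (P.reflectionPerm j i) = P.root i + (-P.pairingIn ℤ i j) • P.root j := by
    rw [P.root_reflectionPerm, P.reflection_apply_root' ℤ, neg_smul, sub_eq_add_neg]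
  have hlt : (b.height (P.reflectionPerm j i)).toNat < m := by
    have h1 := b.height_add_zsmul hroot
    rw [RootPairing.Base.height_one_of_mem_support hj, smul_eq_mul, mul_one] at h1
    have h2 : 0 < b.height i := hi
    omega
  obtain ⟨v, hv, hl, hiv⟩ := ih _ hlt hk rfl
  obtain ⟨h1, h2⟩ := combination_reflect e hA hl (e ⟨j, hj⟩)
  simp only [Equiv.symm_apply_apply, ← hiv, P.root_reflectionPerm, P.reflection_same] at h1 h2
  refine ⟨_, reflect_mem_levels hF hv (j := e ⟨j, hj⟩) (by simp [columns]) ?_,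
    by simpa [reflect] using hl, h1.symm⟩
  have h3 : (dot v ((columns A).getD (e ⟨j, hj⟩) []) + P.pairingIn ℤ i j) • P.root j = 0 := by
    rw [← P.root_reflectionPerm, hroot] at h2
    rw [add_smul, ← sub_eq_zero.2 h2]
    module
  have h4 := (b.linearIndepOn_root.restrict_scalars' ℤ).ne_zero (i := ⟨j, hj⟩)
  have h5 : dot v ((columns A).getD (e ⟨j, hj⟩) []) + P.pairingIn ℤ i j = 0 := by
    rw [← Int.cast_smul_eq_zsmul K] at h3
    exact_mod_cast (smul_eq_zero.1 h3).resolve_right h4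
  omega

/-- A root system whose Cartan matrix has `m` positive roots has `2 * m` roots. -/
lemma natCard_eq_of_hasPositiveRoots [CharZero K] [Finite ι] [P.IsRootSystem] [P.IsReduced]
    {h m : ℕ} (hP : HasPositiveRoots A h m) : Nat.card ι = 2 * m := by
  obtain ⟨hempty, hlen, hnodup, hpos⟩ := hP
  set S := levels (columns A) h (simples n) with hS
  have hcols : (columns A).length = n := by simp [columns]
  have hmem : ∀ v ∈ S, v.length = n ∧ combination e v ∈ Set.range P.root := by
    refine forall_mem_levels (p := fun v => v.length = n ∧ combination e v ∈ Set.range P.root)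
      ?_ h (simples n) ?_
    · rintro v j hj ⟨hv, i, hi⟩
      refine ⟨by simpa [reflect] using hv, P.reflectionPerm (e.symm ⟨j, hcols ▸ hj⟩) i, ?_⟩
      rw [(combination_reflect e hA hv ⟨j, hcols ▸ hj⟩).1, ← hi, P.root_reflectionPerm]
    · intro v hv
      obtain ⟨j, rfl⟩ := (List.mem_ofFn' _ _).1 hv
      refine ⟨by simp, e.symm j, ?_⟩
      rw [← combination_simple e j]
      simp [simples]
  have hroot : ∀ i, ∃ v ∈ S, P.root i = combination e v ∨ P.root i = -combination e v := by
    intro i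
    let := P.indexNeg
    rcases RootPairing.Base.IsPos.or_neg b i with hi | hi
    · obtain ⟨v, hv, -, h⟩ := exists_mem_levels_of_isPos e hA hempty hi
      exact ⟨v, hv, Or.inl h⟩
    · obtain ⟨v, hv, -, h⟩ := exists_mem_levels_of_isPos e hA hempty hi
      refine ⟨v, hv, Or.inr ?_⟩
      rw [← h, P.indexNeg_neg, P.root_reflectionPerm, P.reflection_apply_self, neg_neg]
  have hneg : ∀ v ∈ S, ∀ w ∈ S, combination e v ≠ -combination e w := by
    intro v hv w hw hvw
    have h1 : combination e (w.map Neg.neg) = -combination e w := by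
      simp only [combination, ← Finset.sum_neg_distrib]
      refine Finset.sum_congr rfl fun i _ => ?_
      have : (w.map Neg.neg).getD i 0 = -w.getD i 0 := by
        have hi : (i : ℕ) < w.length := (hmem w hw).1 ▸ i.2
        simp [hi]
      rw [this, neg_smul]
    have h2 : v = w.map Neg.neg := combination_injOn e (hmem v hv).1
      (by simpa using (hmem w hw).1) (hvw.trans h1.symm)
    have h3 := hpos v hv
    have h4 := hpos w hw
    rw [h2, ← List.sum_neg] at h3
    omega
  classical
  have hinj : Set.InjOn (combination e) (S.toFinset : Set (List ℤ)) := fun v hv w hw =>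
    combination_injOn e (hmem v (by simpa using hv)).1 (hmem w (by simpa using hw)).1
  have hrange : Set.range P.root =
      ((S.toFinset.image (combination e) ∪ S.toFinset.image (fun v => -combination e v) :
        Finset M) : Set M) := by
    ext x
    simp only [Set.mem_range, Finset.coe_union, Finset.coe_image, List.coe_toFinset, Set.mem_union,
      Set.mem_image, Set.mem_ofPred_eq]
    constructor
    · rintro ⟨i, rfl⟩
      obtain ⟨v, hv, hi | hi⟩ := hroot i
      · exact Or.inl ⟨v, hv, hi.symm⟩
      · exact Or.inr ⟨v, hv, hi.symm⟩
    · rintro (⟨v, hv, rfl⟩ | ⟨v, hv, rfl⟩)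
      · exact (hmem v hv).2
      · exact (P.neg_mem_range_root_iff).2 (hmem v hv).2
  have hcard : Nat.card ι = (Set.range P.root).ncard := by
    rw [← Nat.card_coe_set_eq, Nat.card_range_of_injective P.root.injective]
  rw [hcard, hrange, Set.ncard_coe_finset, Finset.card_union_of_disjoint,
    Finset.card_image_of_injOn hinj, Finset.card_image_of_injOn
      (fun v hv w hw h => hinj hv hw (neg_injective h)), List.toFinset_card_of_nodup hnodup, hlen]
  · ring
  · rw [Finset.disjoint_left]
    simp only [Finset.mem_image, List.mem_toFinset]
    rintro _ ⟨v, hv, rfl⟩ ⟨w, hw, h⟩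
    exact hneg v hv w hw h.symm

end

lemma hasPositiveRoots_A_one : HasPositiveRoots (CartanMatrix.A 1) 1 1 := by decide +kernel
lemma hasPositiveRoots_A_five : HasPositiveRoots (CartanMatrix.A 5) 5 15 := by decide +kernel
lemma hasPositiveRoots_C_three : HasPositiveRoots (CartanMatrix.C 3) 5 9 := by decide +kernel
lemma hasPositiveRoots_D_four : HasPositiveRoots (CartanMatrix.D 4) 5 12 := by decide +kernel
lemma hasPositiveRoots_D_eight : HasPositiveRoots (CartanMatrix.D 8) 13 56 := by decide +kernel
lemma hasPositiveRoots_F_four : HasPositiveRoots CartanMatrix.F₄ 11 24 := by decide +kernel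
lemma hasPositiveRoots_E_six : HasPositiveRoots CartanMatrix.E₆ 11 36 := by decide +kernel
lemma hasPositiveRoots_E_eight : HasPositiveRoots CartanMatrix.E₈ 29 120 := by decide +kernel
end RootCount

/-! ### Compact Lie algebras of a given type: dimension and equivariant maps -/

/-- The Dynkin diagram of the Cartan matrix `A` is connected. -/
def HasConnectedDiagram {n : ℕ} (A : Matrix (Fin n) (Fin n) ℤ) : Prop :=
  ∀ s : Set (Fin n), s.Nonempty → (∀ i ∈ s, ∀ j, A i j ≠ 0 → j ∈ s) → s = Set.univ

/-- A diagram is connected if every node except the first is joined to an earlier one. -/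
lemma hasConnectedDiagram_of_exists_lt {n : ℕ} [NeZero n] {A : Matrix (Fin n) (Fin n) ℤ}
    (h : ∀ i, i = 0 ∨ ∃ j, j < i ∧ A i j ≠ 0 ∧ A j i ≠ 0) : HasConnectedDiagram A := by
  rintro s ⟨i, hi⟩ hs
  have h0 : 0 ∈ s := by
    induction i using WellFoundedLT.induction with
    | _ i ih =>
      rcases h i with rfl | ⟨j, hj, hij, -⟩
      · exact hi
      · exact ih j hj (hs i hi j hij)
  rw [Set.eq_univ_iff_forall]
  intro i
  induction i using WellFoundedLT.induction with
  | _ i ih =>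
    rcases h i with rfl | ⟨j, hj, -, hji⟩
    · exact h0
    · exact hs j (ih j hj) i hji

lemma hasConnectedDiagram_A_one : HasConnectedDiagram (CartanMatrix.A 1) :=
  hasConnectedDiagram_of_exists_lt <| by simp [Fin.forall_fin_succ]

lemma hasConnectedDiagram_C_three : HasConnectedDiagram (CartanMatrix.C 3) :=
  hasConnectedDiagram_of_exists_lt <| by intro i; fin_cases i <;> decide

lemma hasConnectedDiagram_D_four : HasConnectedDiagram (CartanMatrix.D 4) :=
  hasConnectedDiagram_of_exists_lt <| by intro i; fin_cases i <;> decide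

section Killing

open LieAlgebra LieAlgebra.IsKilling LieModule Module

variable {L : Type*} [LieRing L] [LieAlgebra ℂ L] [FiniteDimensional ℂ L] [IsKilling ℂ L]
  {H : LieSubalgebra ℂ L} [H.IsCartanSubalgebra]

/-- The dimension is that of a Cartan subalgebra plus the number of roots, all root spaces being
lines. -/
lemma finrank_eq_finrank_cartan_add_card_root [Nontrivial L] :
    finrank ℂ L = finrank ℂ H + Nat.card H.root := by
  classical
  have hint : DirectSum.IsInternal
      fun χ : Weight ℂ H L => (genWeightSpace L χ).toSubmodule := by
    rw [DirectSum.isInternal_submodule_iff_iSupIndep_and_iSup_eq_top]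
    refine ⟨LieSubmodule.iSupIndep_toSubmodule.2 (iSupIndep_genWeightSpace' ℂ H L), ?_⟩
    rw [← LieSubmodule.iSup_toSubmodule, iSup_genWeightSpace_eq_top' ℂ H L]
    rfl
  have hsum := (LinearEquiv.finrank_eq (LinearEquiv.ofBijective
    (DirectSum.coeLinearMap fun χ : Weight ℂ H L => (genWeightSpace L χ).toSubmodule) hint)).symm
  rw [finrank_directSum] at hsum
  rw [hsum, ← Finset.sum_filter_not_add_sum_filter Finset.univ
    (fun χ : Weight ℂ H L => χ.IsNonZero)]
  congr 1
  · rw [Finset.sum_eq_single_of_mem (0 : Weight ℂ H L)]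
    · have : (genWeightSpace L ((0 : Weight ℂ H L) : H → ℂ)).toSubmodule = H.toSubmodule := by
        rw [FunLike.coe_zero, ← H.coe_toLieSubmodule, ← rootSpace_zero_eq]
      rw [this]; rfl
    · simpa using Weight.isZero_zero
    · intro χ hχ h0
      exact absurd (Weight.isZero_iff_eq_zero.1 (by simpa using hχ)) h0
  · rw [Finset.sum_congr rfl (g := fun _ => 1)]
    · rw [Finset.sum_const, smul_eq_mul, mul_one, Nat.card_eq_fintype_card, Fintype.card_coe]
    · intro χ hχ
      exact finrank_rootSpace_eq_one χ (by simpa using hχ)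

/-- An endomorphism that commutes with the adjoint action acts by one scalar on the root space of a
root and on its coroot. -/
lemma exists_smul_of_equivariant (T : L →ₗ[ℂ] L) (hT : ∀ x y, T ⁅x, y⁆ = ⁅T x, y⁆) (α : H.root) :
    ∃ t : ℂ, T (coroot α.1 : H) = t • ((coroot α.1 : H) : L) ∧
      ∀ x ∈ rootSpace H α.1, T x = t • x := by
  have hT' : ∀ x y, T ⁅x, y⁆ = ⁅x, T y⁆ := fun x y => by
    rw [← lie_skew, map_neg, hT, lie_skew]
  have hα : α.1.IsNonZero := LieSubalgebra.isNonZero_coe_root α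
  obtain ⟨h, e, f, hs, he, hf⟩ := exists_isSl2Triple_of_weight_isNonZero hα
  have hh := hs.h_eq_coroot hα he hf
  have hTe : T e ∈ rootSpace H α.1 := by
    refine weightSpace_le_genWeightSpace L _ ((mem_weightSpace _ _).2 fun x => ?_)
    rw [LieSubalgebra.coe_bracket_of_module, ← hT', ← LieSubalgebra.coe_bracket_of_module,
      lie_eq_smul_of_mem_rootSpace he, map_smul]
  obtain ⟨t, ht⟩ := (finrank_eq_one_iff_of_nonzero' (⟨e, he⟩ : rootSpace H α.1)
    (by simpa using hs.e_ne_zero)).1 (finrank_rootSpace_eq_one α.1 hα) ⟨T e, hTe⟩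
  have ht : T e = t • e := congrArg Subtype.val ht.symm
  refine ⟨t, ?_, fun x hx => ?_⟩
  · rw [← hh, ← hs.lie_e_f, hT, ht, smul_lie]
  · obtain ⟨c, hc⟩ := (finrank_eq_one_iff_of_nonzero' (⟨e, he⟩ : rootSpace H α.1)
      (by simpa using hs.e_ne_zero)).1 (finrank_rootSpace_eq_one α.1 hα) ⟨x, hx⟩
    have hc : x = c • e := congrArg Subtype.val hc.symm
    rw [hc, map_smul, ht, smul_comm]

/-- An endomorphism that commutes with the adjoint action of a Lie algebra with connected Dynkin
diagram is a scalar. -/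
lemma exists_forall_eq_smul_of_equivariant {n : ℕ} [NeZero n] (b : (rootSystem H).Base)
    (e : b.support ≃ Fin n)
    {A : Matrix (Fin n) (Fin n) ℤ} (hA : Matrix.reindex e e b.cartanMatrix = A)
    (hconn : HasConnectedDiagram A)
    (T : L →ₗ[ℂ] L) (hT : ∀ x y, T ⁅x, y⁆ = ⁅T x, y⁆) : ∃ t : ℂ, ∀ x, T x = t • x := by
  classical
  choose t ht₁ ht₂ using fun α => exists_smul_of_equivariant T hT (H := H) α
  have hlink : ∀ α β : H.root, α.1 (coroot β.1) ≠ 0 → t α = t β := by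
    intro α β h
    obtain ⟨x, hx, hx0⟩ := α.1.exists_ne_zero
    have h1 : ⁅((coroot β.1 : H) : L), x⁆ = α.1 (coroot β.1) • x :=
      lie_eq_smul_of_mem_rootSpace hx _
    have h2 := hT (coroot β.1 : H) x
    rw [h1, map_smul, ht₂ α x hx, ht₁, smul_lie, h1, smul_smul, smul_smul, mul_comm] at h2
    exact mul_right_cancel₀ h (smul_left_injective ℂ hx0 h2)
  -- The simple roots whose scalar is that of the root `0` are a union of connected components.
  have hsimple : ∀ i, t (e.symm i) = t (e.symm 0) := by
    have h := hconn {i | t (e.symm i) = t (e.symm 0)} ⟨0, rfl⟩ ?_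
    · intro i
      have := Set.mem_univ i
      rwa [← h] at this
    · intro i hi j hij
      change t (e.symm j) = t (e.symm 0)
      rw [← show t (e.symm i) = t (e.symm 0) from hi, eq_comm]
      apply hlink
      rw [← hA] at hij
      intro h0
      apply hij
      rw [Matrix.reindex_apply, Matrix.submatrix_apply,
        b.cartanMatrix_apply_eq_zero_iff_pairing]
      exact h0
  -- The simple coroots span the Cartan subalgebra.
  have hH : ∀ h : H, T h = t (e.symm 0) • (h : L) := by
    intro h
    have : T ∘ₗ H.toSubmodule.subtype = t (e.symm 0) • H.toSubmodule.subtype := by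
      refine b.toCoweightBasis.ext fun i => ?_
      rw [RootPairing.Base.toCoweightBasis_apply]
      have := hsimple (e i)
      rw [Equiv.symm_apply_apply] at this
      rw [← this]
      exact ht₁ i
    exact LinearMap.congr_fun this h
  refine ⟨t (e.symm 0), fun x => ?_⟩
  have hx : x ∈ ⨆ χ : Weight ℂ H L, genWeightSpace L χ := by
    rw [iSup_genWeightSpace_eq_top' ℂ H L]; trivial
  induction hx using LieSubmodule.iSup_induction' with
  | mem χ x hx =>
    by_cases hχ : χ.IsZero
    · have hx : x ∈ rootSpace H 0 := by rwa [hχ.eq] at hx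
      rw [rootSpace_zero_eq] at hx
      exact hH ⟨x, hx⟩
    · have h1 : ⁅((coroot χ : H) : L), x⁆ = (2 : ℂ) • x := by
        rw [← root_apply_coroot hχ]; exact lie_eq_smul_of_mem_rootSpace hx _
      have h2 := hT (coroot χ : H) x
      rw [h1, hH, smul_lie, h1, map_smul, smul_comm] at h2
      exact smul_right_injective _ two_ne_zero h2
  | zero => simp
  | add x y _ _ hx hy => rw [map_add, hx, hy, smul_add]

end Killing

section Compact

open Module LieAlgebra.IsKilling

variable {L : Type*} [LieRing L] [LieAlgebra ℝ L] [FiniteDimensional ℝ L] {n : ℕ} [NeZero n]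
  {A : Matrix (Fin n) (Fin n) ℤ}

lemma IsCompactOfType.finrank_eq (hL : IsCompactOfType A L) {h m : ℕ}
    (hA : RootCount.HasPositiveRoots A h m) : finrank ℝ L = n + 2 * m := by
  obtain ⟨-, hK, H, hH, b, e, he⟩ := hL
  have : Nontrivial (ℂ ⊗[ℝ] L) := by
    obtain ⟨x, -, hx⟩ := (e.symm 0 : H.root).1.exists_ne_zero
    exact ⟨x, 0, hx⟩
  rw [← finrank_baseChange (R := ℂ), finrank_eq_finrank_cartan_add_card_root (H := H),
    RootCount.natCard_eq_of_hasPositiveRoots e he hA, finrank_eq_card_basis b.toCoweightBasis,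
    Fintype.card_congr e, Fintype.card_fin]

/-- An endomorphism that commutes with the adjoint action of a compact Lie algebra with connected
Dynkin diagram is a real scalar: its complexification is a complex scalar, whose real part it is. -/
lemma IsCompactOfType.exists_forall_eq_smul (hL : IsCompactOfType A L)
    (hconn : HasConnectedDiagram A)
    (T : L →ₗ[ℝ] L) (hT : ∀ x y, T ⁅x, y⁆ = ⁅T x, y⁆) : ∃ t : ℝ, ∀ x, T x = t • x := by
  obtain ⟨-, hK, H, hH, b, e, he⟩ := hL
  obtain ⟨t, ht⟩ := exists_forall_eq_smul_of_equivariant b e he hconn (T.baseChange ℂ) fun x y => by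
    induction x using TensorProduct.induction_on with
    | zero => simp
    | add x x' hx hx' => simp only [add_lie, map_add, hx, hx']
    | tmul a x =>
      induction y using TensorProduct.induction_on with
      | zero => simp
      | add y y' hy hy' => simp only [lie_add, map_add, hy, hy']
      | tmul c y => simp [LieAlgebra.ExtendScalars.bracket_tmul, hT]
  refine ⟨t.re, fun x => ?_⟩
  have h := congrArg (fun z => TensorProduct.lid ℝ L (Complex.reLm.rTensor L z)) (ht (1 ⊗ₜ x))
  simpa [TensorProduct.smul_tmul'] using h

end Compact

/-! ### Traces over orthonormal families -/

section Forms

open Module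

variable {g : Type*} [LieRing g] [LieAlgebra ℝ g]

lemma negKilling_comm (x y : g) : negKilling g x y = negKilling g y x := by
  simp [negKilling, LieModule.traceForm_comm ℝ g g x y]

lemma negKilling_lie (x y z : g) : negKilling g ⁅x, y⁆ z = negKilling g x ⁅y, z⁆ := by
  simp [negKilling, LieModule.traceForm_apply_lie_apply]

lemma negKilling_lie_right (x y z : g) : negKilling g ⁅x, y⁆ z = -negKilling g y ⁅x, z⁆ := by
  rw [← lie_skew, map_neg, LinearMap.neg_apply, negKilling_lie]

variable {κ : Type*}

/-- The matrix of `ad x`, compressed to the span of the family `u`, which is meant to be orthonormal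
for the negative of the Killing form. -/
noncomputable def adMatrix (u : κ → g) (x : g) : Matrix κ κ ℝ :=
  Matrix.of fun q p => negKilling g ⁅x, u p⁆ (u q)

lemma adMatrix_transpose (u : κ → g) (x : g) : (adMatrix u x).transpose = -adMatrix u x := by
  ext p q
  simp only [adMatrix, Matrix.transpose_apply, Matrix.of_apply, Matrix.neg_apply]
  rw [negKilling_lie_right, negKilling_comm]

variable [Fintype κ]

/-- The symmetric form `(x, y) ↦ -tr (ad x ∘ ad y)`, the trace being taken over the span of the
orthonormal family `u` (to which the endomorphisms are compressed). If the span is a subalgebra,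
this extends the negative of its Killing form. -/
noncomputable def traceForm (u : κ → g) : LinearMap.BilinForm ℝ g :=
  LinearMap.mk₂ ℝ (fun x y => ∑ p, ∑ q, negKilling g ⁅x, u p⁆ (u q) * negKilling g ⁅y, u p⁆ (u q))
    (fun x x' y => by simp [add_mul, Finset.sum_add_distrib])
    (fun c x y => by simp [mul_assoc, Finset.mul_sum])
    (fun x y y' => by simp [mul_add, Finset.sum_add_distrib])
    (fun c x y => by simp [mul_left_comm, Finset.mul_sum])

lemma traceForm_apply (u : κ → g) (x y : g) : traceForm u x y =
    ∑ p, ∑ q, negKilling g ⁅x, u p⁆ (u q) * negKilling g ⁅y, u p⁆ (u q) := rfl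

lemma traceForm_comm (u : κ → g) (x y : g) : traceForm u x y = traceForm u y x := by
  simp only [traceForm_apply, mul_comm]

lemma traceForm_eq_neg_trace (u : κ → g) (x y : g) :
    traceForm u x y = -(adMatrix u x * adMatrix u y).trace := by
  have h : -(adMatrix u x * adMatrix u y).trace =
      ((adMatrix u x).transpose * adMatrix u y).trace := by
    rw [adMatrix_transpose, Matrix.neg_mul, Matrix.trace_neg]
  rw [h]
  simp [Matrix.trace, Matrix.mul_apply, adMatrix, traceForm_apply]

variable [DecidableEq κ] {u : κ → g}

/-- The family `u` is orthonormal for the negative of the Killing form. -/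
def IsOrthonormal (u : κ → g) : Prop :=
  ∀ p q, negKilling g (u p) (u q) = if p = q then 1 else 0

lemma IsOrthonormal.sum_smul_eq (hu : IsOrthonormal u) {x : g}
    (hx : x ∈ Submodule.span ℝ (Set.range u)) : ∑ p, negKilling g x (u p) • u p = x := by
  induction hx using Submodule.span_induction with
  | mem x hx => obtain ⟨q, rfl⟩ := hx; simp [hu q, ite_smul]
  | zero => simp
  | add x y _ _ hx hy =>
    simp only [map_add, LinearMap.add_apply, add_smul, Finset.sum_add_distrib, hx, hy]
  | smul c x _ hx =>
    simp only [map_smul, LinearMap.smul_apply, smul_eq_mul, mul_smul, ← Finset.smul_sum, hx]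

lemma IsOrthonormal.eq_zero (hu : IsOrthonormal u) {x : g}
    (hx : x ∈ Submodule.span ℝ (Set.range u)) (h : ∀ p, negKilling g x (u p) = 0) : x = 0 := by
  rw [← hu.sum_smul_eq hx]; simp [h]

lemma IsOrthonormal.linearIndependent (hu : IsOrthonormal u) : LinearIndependent ℝ u := by
  rw [Fintype.linearIndependent_iff]
  intro c hc p
  have := congrArg (fun x => negKilling g x (u p)) hc
  simpa [LinearMap.sum_apply, hu _ _] using this

lemma IsOrthonormal.adMatrix_lie (hu : IsOrthonormal u)
    (hlie : ∀ x ∈ Submodule.span ℝ (Set.range u), ∀ y ∈ Submodule.span ℝ (Set.range u),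
      ⁅x, y⁆ ∈ Submodule.span ℝ (Set.range u))
    {x y : g} (hx : x ∈ Submodule.span ℝ (Set.range u))
    (hy : y ∈ Submodule.span ℝ (Set.range u)) :
    adMatrix u ⁅x, y⁆ = adMatrix u x * adMatrix u y - adMatrix u y * adMatrix u x := by
  have key : ∀ x y : g, y ∈ Submodule.span ℝ (Set.range u) → ∀ p q,
      (adMatrix u x * adMatrix u y) q p = negKilling g ⁅x, ⁅y, u p⁆⁆ (u q) := by
    intro x y hy p q
    conv_rhs => rw [← hu.sum_smul_eq (hlie y hy (u p) (Submodule.subset_span ⟨p, rfl⟩))]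
    simp [Matrix.mul_apply, adMatrix, lie_sum, mul_comm]
  ext q p
  rw [Matrix.sub_apply, key x y hy, key y x hx, ← LinearMap.sub_apply, ← map_sub, ← lie_lie]
  rfl

/-- If the span of `u` is a subalgebra, then `ad` on it is represented by `adMatrix u`, so that the
invariance of `traceForm u` is the identity `tr ([X, Y] Z) = tr (X [Y, Z])`. -/
lemma IsOrthonormal.traceForm_lie (hu : IsOrthonormal u)
    (hlie : ∀ x ∈ Submodule.span ℝ (Set.range u), ∀ y ∈ Submodule.span ℝ (Set.range u),
      ⁅x, y⁆ ∈ Submodule.span ℝ (Set.range u))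
    {x y z : g} (hx : x ∈ Submodule.span ℝ (Set.range u))
    (hy : y ∈ Submodule.span ℝ (Set.range u)) (hz : z ∈ Submodule.span ℝ (Set.range u)) :
    traceForm u ⁅x, y⁆ z = traceForm u x ⁅y, z⁆ := by
  rw [traceForm_eq_neg_trace, traceForm_eq_neg_trace, hu.adMatrix_lie hlie hx hy,
    hu.adMatrix_lie hlie hy hz, sub_mul, mul_sub, Matrix.trace_sub, Matrix.trace_sub,
    Matrix.mul_assoc, Matrix.mul_assoc (adMatrix u y), Matrix.trace_mul_comm (adMatrix u y),
    Matrix.mul_assoc (adMatrix u x) (adMatrix u z)]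

lemma IsOrthonormal.traceForm_eq_negKilling (hu : IsOrthonormal u)
    (hspan : Submodule.span ℝ (Set.range u) = ⊤) (x y : g) :
    traceForm u x y = negKilling g x y := by
  let b : Basis κ ℝ g := Basis.mk hu.linearIndependent hspan.ge
  have hb : ∀ p, b p = u p := fun p => by simp [b]
  have hrepr : ∀ v q, b.repr v q = negKilling g v (u q) := by
    intro v q
    conv_rhs => rw [← b.sum_repr v]
    simp [LinearMap.sum_apply, hb, hu _ _]
  have hmat : ∀ x, LinearMap.toMatrix b b (LieAlgebra.ad ℝ g x) = adMatrix u x := by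
    intro x; ext q p
    rw [LinearMap.toMatrix_apply, hrepr, hb]; rfl
  rw [traceForm_eq_neg_trace, ← hmat, ← hmat, ← LinearMap.toMatrix_mul,
    ← LinearMap.trace_eq_matrix_trace]
  rfl

end Forms

/-! ### Invariant forms on simple and on irreducible summands -/

section Schur

open Module

variable {g : Type*} [LieRing g] [LieAlgebra ℝ g] {d : ℕ}

lemma span_range_coe_basis {m : Submodule ℝ g} (e : Basis (Fin d) ℝ m) :
    Submodule.span ℝ (Set.range fun a => (e a : g)) = m := by
  have : (Set.range fun a => (e a : g)) = m.subtype '' Set.range e := by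
    rw [← Set.range_comp]; rfl
  rw [this, ← Submodule.map_span, e.span_eq, Submodule.map_top, Submodule.range_subtype]

/-- An invariant symmetric form is a multiple of `B` on an irreducible module: if `l` is an
eigenvalue of its Gram matrix, then `C - l B` has a nonzero invariant radical in the module. -/
lemma IsAdIrreducible.exists_eq_mul {k : LieSubalgebra ℝ g} {m : Submodule ℝ g}
    (hm : IsAdIrreducible k m) (e : Basis (Fin d) ℝ m)
    (he : IsOrthonormal fun a => (e a : g)) (C : LinearMap.BilinForm ℝ g)
    (hsymm : ∀ x ∈ m, ∀ y ∈ m, C x y = C y x)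
    (hC : ∀ x ∈ k, ∀ y ∈ m, ∀ z ∈ m, C ⁅x, y⁆ z = -C y ⁅x, z⁆) :
    ∃ l : ℝ, ∀ x ∈ m, ∀ y ∈ m, C x y = l * negKilling g x y := by
  have hM : (Matrix.of fun a b => C (e a : g) (e b : g)).IsHermitian := by
    ext a b
    simpa using hsymm _ (e b).2 _ (e a).2
  have hd : 0 < d := by
    rcases Nat.eq_zero_or_pos d with rfl | h
    · refine absurd ?_ hm.ne_bot
      rw [← span_range_coe_basis e, Set.range_eq_empty, Submodule.span_empty]
    · exact h
  let i : Fin d := ⟨0, hd⟩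
  set l := hM.eigenvalues i
  set v : Fin d → ℝ := (hM.eigenvectorBasis i).ofLp with hv
  have hMv := hM.mulVec_eigenvectorBasis i
  have hv0 : v ≠ 0 := by
    intro h
    apply hM.eigenvectorBasis.toBasis.ne_zero i
    ext a
    simpa using congrFun h a
  let W : Submodule ℝ g :=
    { carrier := {x | x ∈ m ∧ ∀ y ∈ m, C x y = l * negKilling g x y}
      add_mem' := fun {x x'} hx hx' => ⟨m.add_mem hx.1 hx'.1, fun y hy => by
        simp [hx.2 y hy, hx'.2 y hy, mul_add]⟩
      zero_mem' := ⟨m.zero_mem, by simp⟩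
      smul_mem' := fun c x hx => ⟨m.smul_mem c hx.1, fun y hy => by
        simp [hx.2 y hy, mul_left_comm]⟩ }
  have hW := hm.eq_bot_or_eq W (fun x hx => hx.1) fun x hx y hy =>
    ⟨hm.invariant x hx y hy.1, fun z hz => by
      rw [hC x hx y hy.1 z hz, hy.2 _ (hm.invariant x hx z hz), negKilling_lie_right, mul_neg]⟩
  refine ⟨l, ?_⟩
  rcases hW with hW | hW
  · exfalso
    have hB : ∀ b, negKilling g (∑ a, v a • (e a : g)) (e b : g) = v b := fun b => by
      simp [LinearMap.sum_apply, he _ _]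
    have hx : ∑ a, v a • (e a : g) ∈ W := by
      refine ⟨m.sum_mem fun a _ => m.smul_mem _ (e a).2, fun y hy => ?_⟩
      rw [← span_range_coe_basis e] at hy
      induction hy using Submodule.span_induction with
      | mem y hy =>
        obtain ⟨b, rfl⟩ := hy
        have h1 := congrFun hMv b
        simp only [Matrix.mulVec, dotProduct, Matrix.of_apply, Pi.smul_apply, smul_eq_mul] at h1
        rw [hB, hv, ← h1]
        simp only [map_sum, map_smul, LinearMap.sum_apply, LinearMap.smul_apply, smul_eq_mul]
        exact Finset.sum_congr rfl fun a _ => by rw [hsymm _ (e a).2 _ (e b).2, mul_comm]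
      | zero => simp
      | add y y' _ _ h h' => rw [map_add, h, h', map_add, mul_add]
      | smul c y _ h => rw [map_smul, h, map_smul, smul_eq_mul, smul_eq_mul, mul_left_comm]
    rw [hW, Submodule.mem_bot] at hx
    apply hv0
    ext b
    rw [← hB b, hx]; simp
  · intro x hx
    rw [← hW] at hx
    exact hx.2

lemma eq_zero_of_forall_negKilling_eq_zero {m : Submodule ℝ g} (e : Basis (Fin d) ℝ m)
    (he : IsOrthonormal fun a => (e a : g)) {x : g} (hx : x ∈ m)
    (h : ∀ y ∈ m, negKilling g x y = 0) : x = 0 :=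
  he.eq_zero (by rwa [span_range_coe_basis e]) fun a => h _ (e a).2

lemma IsCompactOfType.eq_zero_of_central [FiniteDimensional ℝ g] {s : LieSubalgebra ℝ g}
    {ι : Type*} {A : Matrix ι ι ℤ} (hs : IsCompactOfType A s) :
    ∀ z ∈ s, (∀ x ∈ s, ⁅z, x⁆ = 0) → z = 0 := by
  intro z hz h
  by_contra h0
  have := hs.1 ⟨z, hz⟩ (fun h => h0 (congrArg Subtype.val h))
  have had : LieAlgebra.ad ℝ s ⟨z, hz⟩ = 0 := by
    ext x; exact h x x.2
  simp [negKilling, killingForm_apply_apply, had] at this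

variable {s : LieSubalgebra ℝ g} (e : Basis (Fin d) ℝ s.toSubmodule)
  (he : IsOrthonormal fun a => (e a : g))
include he

/-- A linear functional is represented on `s` by an element of `s`. -/
lemma exists_negKilling_eq (f : g →ₗ[ℝ] ℝ) :
    ∃ z ∈ s, ∀ x ∈ s, negKilling g z x = f x := by
  refine ⟨∑ a, f (e a) • (e a : g), s.toSubmodule.sum_mem fun a _ =>
    s.toSubmodule.smul_mem _ (e a).2, fun x hx => ?_⟩
  have hx' : x ∈ Submodule.span ℝ (Set.range fun a => (e a : g)) := by
    rw [span_range_coe_basis e]; exact hx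
  conv_rhs => rw [← he.sum_smul_eq hx']
  simp [LinearMap.sum_apply, mul_comm, negKilling_comm x]

/-- An invariant form vanishes between commuting subalgebras if one of them has trivial center. -/
lemma eq_zero_of_commute {t : LieSubalgebra ℝ g} (hst : ∀ x ∈ s, ∀ y ∈ t, ⁅x, y⁆ = 0)
    (hs : ∀ z ∈ s, (∀ x ∈ s, ⁅z, x⁆ = 0) → z = 0) (C : LinearMap.BilinForm ℝ g)
    (hC : ∀ x ∈ s, ∀ y ∈ s, ∀ z ∈ t, C ⁅x, y⁆ z = C x ⁅y, z⁆) :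
    ∀ x ∈ s, ∀ y ∈ t, C x y = 0 := by
  intro x hx y hy
  -- The element `z` of `s` representing `C · y` is central.
  obtain ⟨z, hz, hzC⟩ := exists_negKilling_eq e he (C.flip y)
  have hz0 : z = 0 := by
    refine hs z hz fun w hw => ?_
    refine eq_zero_of_forall_negKilling_eq_zero e he (s.lie_mem hz hw) fun v hv => ?_
    rw [negKilling_lie, hzC _ (s.lie_mem hw hv), LinearMap.BilinForm.flip_apply, hC w hw v hv y hy,
      hst v hv y hy, map_zero]
  have := hzC x hx
  rw [hz0] at this
  simpa using this.symm

/-- An invariant form is a multiple of `B` on a compact subalgebra with connected Dynkin diagram. -/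
lemma IsCompactOfType.exists_eq_mul [FiniteDimensional ℝ g] {n : ℕ} [NeZero n]
    {A : Matrix (Fin n) (Fin n) ℤ} (hs : IsCompactOfType A s)
    (hconn : HasConnectedDiagram A)
    (C : LinearMap.BilinForm ℝ g)
    (hC : ∀ x ∈ s, ∀ y ∈ s, ∀ z ∈ s, C ⁅x, y⁆ z = C x ⁅y, z⁆) :
    ∃ c : ℝ, ∀ x ∈ s, ∀ y ∈ s, C x y = c * negKilling g x y := by
  choose T' hT'mem hT' using fun x : s => exists_negKilling_eq e he (C x)
  have huniq : ∀ x ∈ s, ∀ y ∈ s, (∀ z ∈ s, negKilling g x z = negKilling g y z) → x = y := by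
    intro x hx y hy h
    rw [← sub_eq_zero]
    refine eq_zero_of_forall_negKilling_eq_zero e he (s.sub_mem hx hy) fun z hz => ?_
    simp [h z hz]
  let T : s →ₗ[ℝ] s :=
    { toFun := fun x => ⟨T' x, hT'mem x⟩
      map_add' := fun x y => Subtype.ext <| huniq _ (hT'mem _) _
        (s.add_mem (hT'mem _) (hT'mem _)) fun z hz => by simp [hT' _ z hz]
      map_smul' := fun c x => Subtype.ext <| huniq _ (hT'mem _) _
        (s.smul_mem c (hT'mem _)) fun z hz => by simp [hT' _ z hz] }
  obtain ⟨c, hc⟩ := hs.exists_forall_eq_smul hconn T fun x y => Subtype.ext <|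
    huniq _ (hT'mem _) _ (s.lie_mem (hT'mem _) y.2) fun z hz => by
      rw [hT' _ z hz]
      change C ⁅(x : g), (y : g)⁆ z = negKilling g ⁅T' x, (y : g)⁆ z
      rw [negKilling_lie, hC x x.2 y y.2 z hz, hT' x _ (s.lie_mem y.2 hz)]
  refine ⟨c, fun x hx y hy => ?_⟩
  rw [← hT' ⟨x, hx⟩ y hy]
  have := congrArg Subtype.val (hc ⟨x, hx⟩)
  change T' ⟨x, hx⟩ = c • x at this
  rw [this]; simp

end Schur

/-! ### The numbers `(i j l)` and their linear relations -/

instance : DecidableEq Idx := fun i j => by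
  cases i <;> cases j <;> first | exact isTrue rfl | exact isFalse (by rintro ⟨⟩)

instance : Fintype Idx := ⟨{i1, i2, i3, i4, i5}, by rintro (_ | _ | _ | _ | _) <;> decide⟩

lemma Idx.sum_univ {M : Type*} [AddCommMonoid M] (f : Idx → M) :
    ∑ i, f i = f i1 + (f i2 + (f i3 + (f i4 + f i5))) := by
  have : (Finset.univ : Finset Idx) = {i1, i2, i3, i4, i5} := rfl
  rw [this]
  repeat rw [Finset.sum_insert (by decide)]
  rw [Finset.sum_singleton]

section Triple

open Module

variable {g : Type*} [LieRing g] [LieAlgebra ℝ g] {V : Idx → Submodule ℝ g} {d : Idx → ℕ}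
  (e : ∀ i, Basis (Fin (d i)) ℝ (V i))

lemma triple_nonneg (i j l : Idx) : 0 ≤ triple e i j l :=
  Finset.sum_nonneg fun _ _ => Finset.sum_nonneg fun _ _ => Finset.sum_nonneg fun _ _ => sq_nonneg _

lemma triple_swap_left (i j l : Idx) : triple e i j l = triple e j i l := by
  unfold triple
  rw [Finset.sum_comm]
  refine Finset.sum_congr rfl fun b _ => Finset.sum_congr rfl fun a _ =>
    Finset.sum_congr rfl fun c _ => ?_
  rw [← lie_skew, map_neg, LinearMap.neg_apply, neg_sq]

lemma triple_swap_right (i j l : Idx) : triple e i j l = triple e i l j := by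
  unfold triple
  refine Finset.sum_congr rfl fun a _ => ?_
  rw [Finset.sum_comm]
  refine Finset.sum_congr rfl fun c _ => Finset.sum_congr rfl fun b _ => ?_
  rw [negKilling_lie_right, neg_sq, negKilling_comm]

lemma triple_eq_zero {i j l : Idx}
    (h : ∀ x ∈ V i, ∀ y ∈ V j, ∀ z ∈ V l, negKilling g ⁅x, y⁆ z = 0) : triple e i j l = 0 := by
  simp [triple, h _ (e i _).2 _ (e j _).2 _ (e l _).2]

lemma negKilling_lie_eq_zero_of_triple_eq_zero {i j l : Idx} (h : triple e i j l = 0) :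
    ∀ x ∈ V i, ∀ y ∈ V j, ∀ z ∈ V l, negKilling g ⁅x, y⁆ z = 0 := by
  have h0 : ∀ a b c, negKilling g ⁅(e i a : g), (e j b : g)⁆ (e l c : g) = 0 := by
    intro a b c
    unfold triple at h
    rw [Finset.sum_eq_zero_iff_of_nonneg fun _ _ => Finset.sum_nonneg fun _ _ =>
      Finset.sum_nonneg fun _ _ => sq_nonneg _] at h
    have h := h a (Finset.mem_univ a)
    rw [Finset.sum_eq_zero_iff_of_nonneg fun _ _ => Finset.sum_nonneg fun _ _ => sq_nonneg _] at h
    have h := h b (Finset.mem_univ b)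
    rw [Finset.sum_eq_zero_iff_of_nonneg fun _ _ => sq_nonneg _] at h
    exact pow_eq_zero_iff two_ne_zero |>.1 (h c (Finset.mem_univ c))
  intro x hx y hy z hz
  rw [← span_range_coe_basis (e i)] at hx
  rw [← span_range_coe_basis (e j)] at hy
  rw [← span_range_coe_basis (e l)] at hz
  induction hx using Submodule.span_induction with
  | zero => simp
  | add x x' _ _ h h' => simp [h, h']
  | smul c x _ h => simp [h]
  | mem x hx =>
    obtain ⟨a, rfl⟩ := hx
    induction hy using Submodule.span_induction with
    | zero => simp
    | add x x' _ _ h h' => simp [h, h']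
    | smul c x _ h => simp [h]
    | mem y hy =>
      obtain ⟨b, rfl⟩ := hy
      induction hz using Submodule.span_induction with
      | zero => simp
      | add x x' _ _ h h' => simp [h, h']
      | smul c x _ h => simp [h]
      | mem z hz => obtain ⟨c, rfl⟩ := hz; exact h0 a b c

/-- The union of the given bases of the summands `V j` with `j ∈ J`. -/
noncomputable def unionBasis (J : Finset Idx) : (Σ j : J, Fin (d j)) → g := fun p => (e p.1 p.2 : g)

variable {e}

lemma IsAdaptedOrthonormal.unionBasis (he : IsAdaptedOrthonormal e)
    (hV : ∀ i j, i ≠ j → ∀ x ∈ V i, ∀ y ∈ V j, negKilling g x y = 0) (J : Finset Idx) :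
    IsOrthonormal (unionBasis e J) := by
  rintro ⟨i, a⟩ ⟨j, b⟩
  by_cases hij : i = j
  · subst hij
    simp [_root_.unionBasis, he i]
  · have hij' : (i : Idx) ≠ j := fun h => hij (Subtype.ext h)
    simp [_root_.unionBasis, hij, hV _ _ hij' _ (e i a).2 _ (e j b).2]

lemma span_unionBasis (J : Finset Idx) :
    Submodule.span ℝ (Set.range (unionBasis e J)) = ⨆ j ∈ J, V j := by
  have : Set.range (unionBasis e J) = ⋃ j : J, Set.range fun a => (e j a : g) := by
    ext x; simp [unionBasis]
  rw [this, Submodule.span_iUnion, iSup_subtype']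
  simp only [span_range_coe_basis]

lemma finrank_biSup_eq_sum (he : IsAdaptedOrthonormal e)
    (hV : ∀ i j, i ≠ j → ∀ x ∈ V i, ∀ y ∈ V j, negKilling g x y = 0) (J : Finset Idx) :
    finrank ℝ (⨆ j ∈ J, V j : Submodule ℝ g) = ∑ j ∈ J, d j := by
  rw [← span_unionBasis (e := e), finrank_span_eq_card (he.unionBasis hV J).linearIndependent,
    Fintype.card_sigma, ← Finset.sum_coe_sort J]
  simp

/-- The trace of the form `traceForm` of a sum of summands over the summand `V i`. -/
lemma sum_traceForm_unionBasis (i : Idx) (J : Finset Idx) :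
    ∑ a, traceForm (unionBasis e J) (e i a : g) (e i a : g) =
      ∑ j ∈ J, ∑ l ∈ J, triple e i j l := by
  have h : ∀ x : g, traceForm (unionBasis e J) x x =
      ∑ j ∈ J, ∑ l ∈ J, ∑ b, ∑ c, (negKilling g ⁅x, (e j b : g)⁆ (e l c : g)) ^ 2 := by
    intro x
    rw [traceForm_apply, Fintype.sum_sigma, ← Finset.sum_coe_sort J]
    refine Finset.sum_congr rfl fun j _ => ?_
    rw [Finset.sum_comm' (t' := Finset.univ) (s' := fun _ => J) (by simp)]
    refine Finset.sum_congr rfl fun b _ => ?_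
    rw [Fintype.sum_sigma, ← Finset.sum_coe_sort J]
    refine Finset.sum_congr rfl fun l _ => Finset.sum_congr rfl fun c _ => ?_
    rw [sq]; rfl
  simp only [h, triple]
  rw [Finset.sum_comm]
  refine Finset.sum_congr rfl fun j _ => ?_
  rw [Finset.sum_comm]

end Triple

/-- The summands other than `k₁` and `k₂` are the modules `![m₁, m₂, m₃]`, renumbered. -/
lemma Idx.exists_module_eq {g : Type*} [LieRing g] [LieAlgebra ℝ g] {k₁ k₂ : LieSubalgebra ℝ g}
    {m₁ m₂ m₃ : Submodule ℝ g} :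
    ∃ p : Idx → Fin 3, (∀ i, i ≠ i1 → i ≠ i2 → summand k₁ k₂ m₁ m₂ m₃ i = ![m₁, m₂, m₃] (p i)) ∧
      ∀ i j, i ≠ i1 → i ≠ i2 → j ≠ i1 → j ≠ i2 → i ≠ j → p i ≠ p j := by
  refine ⟨fun | i4 => 1 | i5 => 2 | _ => 0, ?_, by decide⟩
  rintro (_ | _ | _ | _ | _) <;> simp [summand]

/-- The indices `l` for which the bracket of the summands `i` and `j` of a generalized Wallach
decomposition may have a component in the summand `l`. -/
def bracketIndices : Idx → Idx → Finset Idx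
  | i1, i1 => {i1}
  | i2, i2 => {i2}
  | i1, i2 | i2, i1 => ∅
  | i1, j | i2, j | j, i1 | j, i2 => {j}
  | i, j => if i = j then {i1, i2} else {i1, i2, i, j}ᶜ

lemma notMem_bracketIndices_of_notMem_listedTriples {i j l : Idx}
    (h : ({i, j, l} : Multiset Idx) ∉ listedTriples) : l ∉ bracketIndices i j := by
  contrapose! h
  simp only [listedTriples, Set.mem_insert_iff, Set.mem_singleton_iff]
  revert i j l
  decide

section Wallach

open Module

variable {g : Type*} [LieRing g] [LieAlgebra ℝ g]
  {k k₁ k₂ : LieSubalgebra ℝ g} {m₁ m₂ m₃ : Submodule ℝ g} {d : Idx → ℕ}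
  {e : ∀ i, Basis (Fin (d i)) ℝ (summand k₁ k₂ m₁ m₂ m₃ i)}

/-- The relations satisfied by the numbers `(i j l)` of a generalized Wallach decomposition with
`k = k₁ ⊕ k₂`, where `k₁` and `k₂` are simple: symmetry, vanishing, the trace of `B` on each summand,
and, in `exists_factor`, the traces on `mᵢ`, `k₁` and `k₂` of the Killing form of `k ⊕ mᵢ`, which
is `-c B` on `mᵢ` and on those ideals `kₛ` that act nontrivially on `mᵢ`. -/
structure TripleRelations (T : Idx → Idx → Idx → ℝ) (d : Idx → ℕ) : Prop where
  nonneg : ∀ i j l, 0 ≤ T i j l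
  swap_left : ∀ i j l, T i j l = T j i l
  swap_right : ∀ i j l, T i j l = T i l j
  eq_zero : ∀ i j l, l ∉ bracketIndices i j → T i j l = 0
  sum_eq : ∀ i, ∑ j, ∑ l, T i j l = d i
  exists_factor : ∀ i, i ≠ i1 → i ≠ i2 → ∃ c : ℝ,
    ∑ j ∈ {i1, i2, i}, ∑ l ∈ {i1, i2, i}, T i j l = c * d i ∧
    ∀ s, s = i1 ∨ s = i2 → T s i i = 0 ∨
      ∑ j ∈ {i1, i2, i}, ∑ l ∈ {i1, i2, i}, T s j l = c * d s
  dim_eq_one : ∀ i, i ≠ i1 → i ≠ i2 → T i1 i i = 0 → T i2 i i = 0 → d i = 1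

lemma IsSumOfIdeals.le_left (h : IsSumOfIdeals k k₁ k₂) {x : g} (hx : x ∈ k₁) : x ∈ k := by
  have : k₁.toSubmodule ≤ k.toSubmodule := h.sup_eq ▸ le_sup_left
  exact this hx

lemma IsSumOfIdeals.le_right (h : IsSumOfIdeals k k₁ k₂) {x : g} (hx : x ∈ k₂) : x ∈ k := by
  have : k₂.toSubmodule ≤ k.toSubmodule := h.sup_eq ▸ le_sup_right
  exact this hx

lemma IsSumOfIdeals.exists_add (h : IsSumOfIdeals k k₁ k₂) {x : g} (hx : x ∈ k) :
    ∃ y ∈ k₁, ∃ z ∈ k₂, y + z = x := by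
  have : x ∈ k₁.toSubmodule ⊔ k₂.toSubmodule := by rw [h.sup_eq]; exact hx
  exact Submodule.mem_sup.1 this

lemma summand_orthogonal (he : IsAdaptedOrthonormal e)
    (hw : IsGeneralizedWallach k ![m₁, m₂, m₃]) (hi : IsSumOfIdeals k k₁ k₂)
    (hz : ∀ z ∈ k₁, (∀ x ∈ k₁, ⁅z, x⁆ = 0) → z = 0) (i j : Idx) (hij : i ≠ j) :
    ∀ x ∈ summand k₁ k₂ m₁ m₂ m₃ i, ∀ y ∈ summand k₁ k₂ m₁ m₂ m₃ j, negKilling g x y = 0 := by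
  have h12 : ∀ x ∈ k₁, ∀ y ∈ k₂, negKilling g x y = 0 :=
    eq_zero_of_commute (e i1) (he i1) hi.lie_eq_zero hz _ fun x _ y _ z _ => negKilling_lie x y z
  intro x hx y hy
  obtain ⟨p, hp, hp'⟩ := Idx.exists_module_eq (k₁ := k₁) (k₂ := k₂) (m₁ := m₁) (m₂ := m₂) (m₃ := m₃)
  by_cases hi' : i = i1 ∨ i = i2
  · have hxk : x ∈ k := by
      rcases hi' with rfl | rfl
      exacts [hi.le_left hx, hi.le_right hx]
    by_cases hj : j = i1 ∨ j = i2
    · rcases hi' with rfl | rfl <;> rcases hj with rfl | rfl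
      · exact absurd rfl hij
      · exact h12 x hx y hy
      · rw [negKilling_comm]; exact h12 y hy x hx
      · exact absurd rfl hij
    · push Not at hj
      rw [hp j hj.1 hj.2] at hy
      exact hw.orthogonal_k _ x hxk y hy
  · push Not at hi'
    rw [hp i hi'.1 hi'.2] at hx
    by_cases hj : j = i1 ∨ j = i2
    · have hyk : y ∈ k := by
        rcases hj with rfl | rfl
        exacts [hi.le_left hy, hi.le_right hy]
      rw [negKilling_comm]
      exact hw.orthogonal_k _ y hyk x hx
    · push Not at hj
      rw [hp j hj.1 hj.2] at hy
      exact hw.orthogonal _ _ (hp' i j hi'.1 hi'.2 hj.1 hj.2 hij) x hx y hy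

end Wallach

/-! ### The relations hold in a generalized Wallach decomposition -/

section Wallach

open Module

variable {g : Type*} [LieRing g] [LieAlgebra ℝ g]
  {k k₁ k₂ : LieSubalgebra ℝ g} {m₁ m₂ m₃ : Submodule ℝ g} {d : Idx → ℕ}
  {e : ∀ i, Basis (Fin (d i)) ℝ (summand k₁ k₂ m₁ m₂ m₃ i)}

lemma iSup_summand_eq_top (hw : IsGeneralizedWallach k ![m₁, m₂, m₃])
    (hi : IsSumOfIdeals k k₁ k₂) : ⨆ i, summand k₁ k₂ m₁ m₂ m₃ i = ⊤ := by
  have hle := le_iSup (summand k₁ k₂ m₁ m₂ m₃)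
  rw [eq_top_iff, ← hw.sup_eq_top, ← hi.sup_eq]
  refine sup_le (sup_le (hle i1) (hle i2)) (iSup_le fun a => ?_)
  fin_cases a
  exacts [hle i3, hle i4, hle i5]

lemma isAdIrreducible_summand (hw : IsGeneralizedWallach k ![m₁, m₂, m₃]) (i : Idx) (h1 : i ≠ i1)
    (h2 : i ≠ i2) : IsAdIrreducible k (summand k₁ k₂ m₁ m₂ m₃ i) := by
  obtain ⟨p, hp, -⟩ := Idx.exists_module_eq (k₁ := k₁) (k₂ := k₂) (m₁ := m₁) (m₂ := m₂) (m₃ := m₃)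
  rw [hp i h1 h2]
  exact hw.irreducible _

lemma lie_self_summand (hw : IsGeneralizedWallach k ![m₁, m₂, m₃]) (i : Idx) (h1 : i ≠ i1)
    (h2 : i ≠ i2) : ∀ x ∈ summand k₁ k₂ m₁ m₂ m₃ i, ∀ y ∈ summand k₁ k₂ m₁ m₂ m₃ i, ⁅x, y⁆ ∈ k := by
  obtain ⟨p, hp, -⟩ := Idx.exists_module_eq (k₁ := k₁) (k₂ := k₂) (m₁ := m₁) (m₂ := m₂) (m₃ := m₃)
  rw [hp i h1 h2]
  exact hw.lie_self _

lemma negKilling_lie_eq_zero (hw : IsGeneralizedWallach k ![m₁, m₂, m₃])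
    (hi : IsSumOfIdeals k k₁ k₂)
    (hV : ∀ i j, i ≠ j → ∀ x ∈ summand k₁ k₂ m₁ m₂ m₃ i, ∀ y ∈ summand k₁ k₂ m₁ m₂ m₃ j,
      negKilling g x y = 0) (i j l : Idx) (hl : l ∉ bracketIndices i j) :
    ∀ x ∈ summand k₁ k₂ m₁ m₂ m₃ i, ∀ y ∈ summand k₁ k₂ m₁ m₂ m₃ j,
      ∀ z ∈ summand k₁ k₂ m₁ m₂ m₃ l, negKilling g ⁅x, y⁆ z = 0 := by
  obtain ⟨p, hp, hp'⟩ := Idx.exists_module_eq (k₁ := k₁) (k₂ := k₂) (m₁ := m₁) (m₂ := m₂) (m₃ := m₃)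
  have hself : ∀ i l : Idx, l ∉ bracketIndices i i →
      (i = i1 ∨ i = i2 → i ≠ l) ∧ (i ≠ i1 ∧ i ≠ i2 → l ≠ i1 ∧ l ≠ i2) := by decide
  have hmixed : ∀ i j l : Idx, l ∉ bracketIndices i j → (i = i1 ∨ i = i2) → j ≠ i1 ∧ j ≠ i2 →
      j ≠ l := by decide
  have hmixed' : ∀ i j l : Idx, l ∉ bracketIndices i j → i ≠ i1 ∧ i ≠ i2 → (j = i1 ∨ j = i2) →
      i ≠ l := by decide
  have hne : ∀ i j l : Idx, l ∉ bracketIndices i j ∧ (i ≠ i1 ∧ i ≠ i2) ∧ (j ≠ i1 ∧ j ≠ i2) ∧ i ≠ j →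
      ∃ t, t ≠ i1 ∧ t ≠ i2 ∧ t ≠ i ∧ t ≠ j ∧ t ≠ l := by decide
  intro x hx y hy z hz
  have hmem : ∀ t, ⁅x, y⁆ ∈ summand k₁ k₂ m₁ m₂ m₃ t → t ≠ l → negKilling g ⁅x, y⁆ z = 0 :=
    fun t ht htl => hV t l htl _ ht _ hz
  have hmod : ∀ a, a ≠ i1 → a ≠ i2 → ∀ x ∈ k, ∀ y ∈ summand k₁ k₂ m₁ m₂ m₃ a,
      ⁅x, y⁆ ∈ summand k₁ k₂ m₁ m₂ m₃ a := fun a h1 h2 =>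
    (isAdIrreducible_summand hw a h1 h2).invariant
  by_cases hik : i = i1 ∨ i = i2
  · have hxk : x ∈ k := by
      rcases hik with rfl | rfl
      exacts [hi.le_left hx, hi.le_right hx]
    by_cases hjk : j = i1 ∨ j = i2
    · rcases hik with rfl | rfl <;> rcases hjk with rfl | rfl
      · exact hmem i1 (k₁.lie_mem hx hy) ((hself _ _ hl).1 (Or.inl rfl))
      · rw [hi.lie_eq_zero x hx y hy]; simp
      · rw [← lie_skew, hi.lie_eq_zero y hy x hx]; simp
      · exact hmem i2 (k₂.lie_mem hx hy) ((hself _ _ hl).1 (Or.inr rfl))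
    · push Not at hjk
      exact hmem j (hmod j hjk.1 hjk.2 x hxk y hy) (hmixed i j l hl hik hjk)
  · push Not at hik
    by_cases hjk : j = i1 ∨ j = i2
    · have hyk : y ∈ k := by
        rcases hjk with rfl | rfl
        exacts [hi.le_left hy, hi.le_right hy]
      refine hmem i ?_ (hmixed' i j l hl hik hjk)
      rw [← lie_skew]
      exact neg_mem (hmod i hik.1 hik.2 y hyk x hx)
    · push Not at hjk
      rcases eq_or_ne i j with rfl | hij
      · obtain ⟨h1, h2⟩ := (hself i l hl).2 hik
        have hz' := hz
        rw [hp l h1 h2] at hz'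
        exact hw.orthogonal_k _ _ (lie_self_summand hw i hik.1 hik.2 x hx y hy) _ hz'
      · obtain ⟨t, ht1, ht2, hti, htj, htl⟩ := hne i j l ⟨hl, hik, hjk, hij⟩
        refine hmem t ?_ htl
        rw [hp t ht1 ht2]
        rw [hp i hik.1 hik.2] at hx
        rw [hp j hjk.1 hjk.2] at hy
        exact hw.lie_ne (p i) (p j) (p t) (hp' _ _ hik.1 hik.2 hjk.1 hjk.2 hij)
          (hp' _ _ hjk.1 hjk.2 ht1 ht2 htj.symm) (hp' _ _ hik.1 hik.2 ht1 ht2 hti.symm) x hx y hy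

/-- The restriction of an invariant form `C` to `k ⊕ m` is, up to the same factor `c`, equal to `B`
on the irreducible module `m` and on each ideal `s` of `k` that acts nontrivially on `m`. -/
lemma factor_eq_or_negKilling_lie_eq_zero {s t : LieSubalgebra ℝ g} {m : Submodule ℝ g}
    {C : LinearMap.BilinForm ℝ g} {c c' : ℝ}
    (hadd : ∀ x ∈ k, ∃ y ∈ s, ∃ z ∈ t, y + z = x)
    (hm : ∀ x ∈ s, ∀ y ∈ m, ⁅x, y⁆ ∈ m) (hself : ∀ x ∈ m, ∀ y ∈ m, ⁅x, y⁆ ∈ k)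
    (hC : ∀ x ∈ s, ∀ y ∈ m, ∀ z ∈ m, C ⁅x, y⁆ z = C x ⁅y, z⁆)
    (hCm : ∀ x ∈ m, ∀ y ∈ m, C x y = c * negKilling g x y)
    (hCs : ∀ x ∈ s, ∀ y ∈ s, C x y = c' * negKilling g x y)
    (hCst : ∀ x ∈ s, ∀ y ∈ t, C x y = 0) (hst : ∀ x ∈ s, ∀ y ∈ t, negKilling g x y = 0) :
    c' = c ∨ ∀ x ∈ s, ∀ y ∈ m, ∀ z ∈ m, negKilling g ⁅x, y⁆ z = 0 := by
  refine or_iff_not_imp_left.2 fun hne x hx y hy z hz => ?_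
  obtain ⟨v, hv, w, hw, hvw⟩ := hadd _ (hself y hy z hz)
  have h1 := hC x hx y hy z hz
  have h2 := negKilling_lie x y z
  rw [hCm _ (hm x hx y hy) z hz, ← hvw, map_add, hCst x hx w hw, hCs x hx v hv, add_zero] at h1
  rw [← hvw, map_add, hst x hx w hw, add_zero] at h2
  rw [← h2] at h1
  have h3 : (c' - c) * negKilling g ⁅x, y⁆ z = 0 := by linarith
  exact (mul_eq_zero.1 h3).resolve_left (sub_ne_zero.2 hne)

/-- If `k` acts trivially on an irreducible module, the module is a line. -/
lemma dim_eq_one_of_triple_eq_zero (he : IsAdaptedOrthonormal e)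
    (hw : IsGeneralizedWallach k ![m₁, m₂, m₃]) (hi : IsSumOfIdeals k k₁ k₂) (i : Idx)
    (hi1 : i ≠ i1) (hi2 : i ≠ i2) (h1 : triple e i1 i i = 0) (h2 : triple e i2 i i = 0) :
    d i = 1 := by
  have hirr := isAdIrreducible_summand (k₁ := k₁) (k₂ := k₂) hw i hi1 hi2
  have hzero : ∀ x ∈ k, ∀ y ∈ summand k₁ k₂ m₁ m₂ m₃ i, ⁅x, y⁆ = 0 := by
    intro x hx y hy
    refine eq_zero_of_forall_negKilling_eq_zero (e i) (he i) (hirr.invariant x hx y hy)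
      fun z hz => ?_
    obtain ⟨v, hv, w, hw, rfl⟩ := hi.exists_add hx
    rw [add_lie, map_add, LinearMap.add_apply,
      negKilling_lie_eq_zero_of_triple_eq_zero e h1 v hv y hy z hz,
      negKilling_lie_eq_zero_of_triple_eq_zero e h2 w hw y hy z hz, add_zero]
  obtain ⟨x, hx, hx0⟩ := Submodule.exists_mem_ne_zero_of_ne_bot hirr.ne_bot
  have hle : ℝ ∙ x ≤ summand k₁ k₂ m₁ m₂ m₃ i := (Submodule.span_singleton_le_iff_mem _ _).2 hx
  have hspan := (hirr.eq_bot_or_eq (ℝ ∙ x) hle fun y hy z hz => by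
    rw [hzero y hy z (hle hz)]; exact zero_mem _).resolve_left (by simpa using hx0)
  have := finrank_span_singleton (K := ℝ) hx0
  rwa [hspan, finrank_eq_card_basis (e i), Fintype.card_fin] at this

lemma tripleRelations [FiniteDimensional ℝ g] (he : IsAdaptedOrthonormal e)
    (hw : IsGeneralizedWallach k ![m₁, m₂, m₃]) (hi : IsSumOfIdeals k k₁ k₂)
    {n₁ n₂ : ℕ} [NeZero n₁] [NeZero n₂] {A₁ : Matrix (Fin n₁) (Fin n₁) ℤ}
    {A₂ : Matrix (Fin n₂) (Fin n₂) ℤ} (h₁ : IsCompactOfType A₁ k₁) (h₂ : IsCompactOfType A₂ k₂)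
    (hA₁ : HasConnectedDiagram A₁) (hA₂ : HasConnectedDiagram A₂) :
    TripleRelations (triple e) d := by
  have hV := summand_orthogonal he hw hi h₁.eq_zero_of_central
  refine ⟨triple_nonneg e, triple_swap_left e, triple_swap_right e, fun i j l hl =>
    triple_eq_zero e (negKilling_lie_eq_zero hw hi hV i j l hl), fun i => ?_, fun i hi1 hi2 => ?_,
    dim_eq_one_of_triple_eq_zero he hw hi⟩
  · rw [← sum_traceForm_unionBasis]
    have hspan : Submodule.span ℝ (Set.range (unionBasis e Finset.univ)) = ⊤ := by
      rw [span_unionBasis, ← iSup_summand_eq_top hw hi]; simp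
    simp only [(he.unionBasis hV _).traceForm_eq_negKilling hspan]
    simp [he i _ _]
  · set u := unionBasis e {i1, i2, i} with hu
    have huo : IsOrthonormal u := he.unionBasis hV _
    have hspan : Submodule.span ℝ (Set.range u) =
        k.toSubmodule ⊔ summand k₁ k₂ m₁ m₂ m₃ i := by
      rw [span_unionBasis, ← hi.sup_eq]
      simp only [Finset.mem_insert, Finset.mem_singleton, iSup_or, iSup_sup_eq, iSup_iSup_eq_left]
      rw [sup_assoc]; rfl
    have hirr := isAdIrreducible_summand (k₁ := k₁) (k₂ := k₂) hw i hi1 hi2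
    have hself := lie_self_summand (k₁ := k₁) (k₂ := k₂) hw i hi1 hi2
    have hk : ∀ x ∈ k, x ∈ Submodule.span ℝ (Set.range u) := fun x hx =>
      hspan ▸ Submodule.mem_sup_left (S := k.toSubmodule) hx
    have hm : ∀ x ∈ summand k₁ k₂ m₁ m₂ m₃ i, x ∈ Submodule.span ℝ (Set.range u) := fun x hx =>
      hspan ▸ Submodule.mem_sup_right hx
    have hlie : ∀ x ∈ Submodule.span ℝ (Set.range u), ∀ y ∈ Submodule.span ℝ (Set.range u),
        ⁅x, y⁆ ∈ Submodule.span ℝ (Set.range u) := by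
      intro x hx y hy
      rw [hspan] at hx hy
      obtain ⟨a, ha, b, hb, rfl⟩ := Submodule.mem_sup.1 hx
      obtain ⟨a', ha', b', hb', rfl⟩ := Submodule.mem_sup.1 hy
      rw [add_lie, lie_add, lie_add]
      refine add_mem (add_mem (hk _ (k.lie_mem ha ha')) (hm _ (hirr.invariant a ha b' hb')))
        (add_mem (hm _ ?_) (hk _ (hself b hb b' hb')))
      rw [← lie_skew]
      exact neg_mem (hirr.invariant a' ha' b hb)
    have hC : ∀ x ∈ Submodule.span ℝ (Set.range u), ∀ y ∈ Submodule.span ℝ (Set.range u),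
        ∀ z ∈ Submodule.span ℝ (Set.range u), traceForm u ⁅x, y⁆ z = traceForm u x ⁅y, z⁆ :=
      fun x hx y hy z hz => huo.traceForm_lie hlie hx hy hz
    have hk₁ : ∀ x ∈ k₁, x ∈ Submodule.span ℝ (Set.range u) := fun x hx => hk x (hi.le_left hx)
    have hk₂ : ∀ x ∈ k₂, x ∈ Submodule.span ℝ (Set.range u) := fun x hx => hk x (hi.le_right hx)
    obtain ⟨c, hc⟩ := hirr.exists_eq_mul (e i) (he i) (traceForm u)
      (fun x _ y _ => traceForm_comm u x y) fun x hx y hy z hz => by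
        rw [← lie_skew, map_neg, LinearMap.neg_apply, hC y (hm y hy) x (hk x hx) z (hm z hz)]
    obtain ⟨c₁, hc₁⟩ := h₁.exists_eq_mul (e i1) (he i1) hA₁ (traceForm u)
      fun x hx y hy z hz => hC x (hk₁ x hx) y (hk₁ y hy) z (hk₁ z hz)
    obtain ⟨c₂, hc₂⟩ := h₂.exists_eq_mul (e i2) (he i2) hA₂ (traceForm u)
      fun x hx y hy z hz => hC x (hk₂ x hx) y (hk₂ y hy) z (hk₂ z hz)
    have hC12 : ∀ x ∈ k₁, ∀ y ∈ k₂, traceForm u x y = 0 :=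
      eq_zero_of_commute (e i1) (he i1) hi.lie_eq_zero h₁.eq_zero_of_central _
        fun x hx y hy z hz => hC x (hk₁ x hx) y (hk₁ y hy) z (hk₂ z hz)
    refine ⟨c, ?_, ?_⟩
    · rw [← sum_traceForm_unionBasis]
      simp only [← hu, hc _ (e i _).2 _ (e i _).2]
      simp [he i _ _, mul_comm]
    · rintro s (rfl | rfl)
      · rcases factor_eq_or_negKilling_lie_eq_zero (s := k₁) (t := k₂) (fun x hx => hi.exists_add hx)
          (fun x hx => hirr.invariant x (hi.le_left hx)) hself
          (fun x hx y hy z hz => hC x (hk₁ x hx) y (hm y hy) z (hm z hz)) hc hc₁ hC12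
          (hV i1 i2 (by decide)) with rfl | h
        · right
          rw [← sum_traceForm_unionBasis]
          simp only [← hu, hc₁ _ (e i1 _).2 _ (e i1 _).2]
          simp [he i1 _ _, mul_comm]
        · exact Or.inl (triple_eq_zero e h)
      · rcases factor_eq_or_negKilling_lie_eq_zero (s := k₂) (t := k₁)
          (fun x hx => (hi.exists_add hx).elim fun y ⟨hy, z, hz, h⟩ =>
            ⟨z, hz, y, hy, (add_comm z y).trans h⟩)
          (fun x hx => hirr.invariant x (hi.le_right hx)) hself
          (fun x hx y hy z hz => hC x (hk₂ x hx) y (hm y hy) z (hm z hz)) hc hc₂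
          (fun x hx y hy => (traceForm_comm u x y).trans (hC12 y hy x hx))
          (hV i2 i1 (by decide)) with rfl | h
        · right
          rw [← sum_traceForm_unionBasis]
          simp only [← hu, hc₂ _ (e i2 _).2 _ (e i2 _).2]
          simp [he i2 _ _, mul_comm]
        · exact Or.inl (triple_eq_zero e h)

end Wallach

/-! ### Solving the relations -/

namespace TripleRelations

variable {T : Idx → Idx → Idx → ℝ} {d : Idx → ℕ} (h : TripleRelations T d)
include h

lemma sum_eq_simplified :
    T i1 i1 i1 + T i1 i3 i3 + T i1 i4 i4 + T i1 i5 i5 = d i1 ∧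
    T i2 i2 i2 + T i2 i3 i3 + T i2 i4 i4 + T i2 i5 i5 = d i2 ∧
    2 * T i1 i3 i3 + 2 * T i2 i3 i3 + 2 * T i3 i4 i5 = d i3 ∧
    2 * T i1 i4 i4 + 2 * T i2 i4 i4 + 2 * T i3 i4 i5 = d i4 ∧
    2 * T i1 i5 i5 + 2 * T i2 i5 i5 + 2 * T i3 i4 i5 = d i5 := by
  have h1 := h.sum_eq i1
  have h2 := h.sum_eq i2
  have h3 := h.sum_eq i3
  have h4 := h.sum_eq i4
  have h5 := h.sum_eq i5
  simp (disch := decide) only [Idx.sum_univ, h.eq_zero, zero_add, add_zero] at h1 h2 h3 h4 h5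
  rw [h.swap_left i3 i1 i3, h.swap_right i3 i3 i1, h.swap_left i3 i1 i3, h.swap_left i3 i2 i3,
    h.swap_right i3 i3 i2, h.swap_left i3 i2 i3, h.swap_right i3 i5 i4] at h3
  rw [h.swap_left i4 i1 i4, h.swap_right i4 i4 i1, h.swap_left i4 i1 i4, h.swap_left i4 i2 i4,
    h.swap_right i4 i4 i2, h.swap_left i4 i2 i4, h.swap_right i4 i5 i3, h.swap_left i4 i3 i5] at h4
  rw [h.swap_left i5 i1 i5, h.swap_right i5 i5 i1, h.swap_left i5 i1 i5, h.swap_left i5 i2 i5,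
    h.swap_right i5 i5 i2, h.swap_left i5 i2 i5, h.swap_right i5 i4 i3, h.swap_left i5 i3 i4,
    h.swap_right i3 i5 i4] at h5
  refine ⟨?_, ?_, ?_, ?_, ?_⟩ <;> linarith

lemma exists_factor_simplified (i : Idx) (hi1 : i ≠ i1) (hi2 : i ≠ i2) : ∃ c : ℝ,
    2 * T i1 i i + 2 * T i2 i i = c * d i ∧
    (T i1 i i = 0 ∨ T i1 i1 i1 + T i1 i i = c * d i1) ∧
    (T i2 i i = 0 ∨ T i2 i2 i2 + T i2 i i = c * d i2) := by
  obtain ⟨c, hc, hs⟩ := h.exists_factor i hi1 hi2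
  have hsum : ∀ f : Idx → ℝ, ∑ j ∈ {i1, i2, i}, f j = f i1 + (f i2 + f i) := fun f => by
    rw [Finset.sum_insert (by simp [hi1.symm]), Finset.sum_insert (by simp [hi2.symm]),
      Finset.sum_singleton]
  have c1 := hs i1 (Or.inl rfl)
  have c2 := hs i2 (Or.inr rfl)
  have z : ∀ j, j ≠ i1 → j ≠ i2 → i1 ∉ bracketIndices i1 j ∧ i2 ∉ bracketIndices i1 j ∧
      i1 ∉ bracketIndices i2 j ∧ i2 ∉ bracketIndices i2 j ∧ j ∉ bracketIndices i1 i1 ∧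
      j ∉ bracketIndices i2 i2 ∧ j ∉ bracketIndices i1 i2 ∧ j ∉ bracketIndices i2 i1 ∧
      i1 ∉ bracketIndices j i1 ∧ i2 ∉ bracketIndices j i1 ∧ i1 ∉ bracketIndices j i2 ∧
      i2 ∉ bracketIndices j i2 ∧ j ∉ bracketIndices j j := by decide
  obtain ⟨z1, z2, z3, z4, z5, z6, z7, z8, z9, z10, z11, z12, z13⟩ := z i hi1 hi2
  simp only [hsum, h.eq_zero _ _ _ z1, h.eq_zero _ _ _ z2, h.eq_zero _ _ _ z3, h.eq_zero _ _ _ z4,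
    h.eq_zero _ _ _ z5, h.eq_zero _ _ _ z6, h.eq_zero _ _ _ z7, h.eq_zero _ _ _ z8,
    h.eq_zero _ _ _ z9, h.eq_zero _ _ _ z10, h.eq_zero _ _ _ z11, h.eq_zero _ _ _ z12,
    h.eq_zero _ _ _ z13, h.eq_zero i1 i1 i2 (by decide), h.eq_zero i1 i2 i1 (by decide),
    h.eq_zero i1 i2 i2 (by decide), h.eq_zero i2 i1 i1 (by decide), h.eq_zero i2 i1 i2 (by decide),
    h.eq_zero i2 i2 i1 (by decide), add_zero, zero_add] at hc c1 c2
  rw [h.swap_left i i1 i, h.swap_right i i i1, h.swap_left i i1 i, h.swap_left i i2 i,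
    h.swap_right i i i2, h.swap_left i i2 i] at hc
  exact ⟨c, by linarith, c1, c2⟩

lemma eq_of_dim_E6 (d1 : d i1 = 3) (d2 : d i2 = 21) (d3 : d i3 = 14) (d4 : d i4 = 28)
    (d5 : d i5 = 12) (h133 : T i1 i3 i3 = 0) :
    T i1 i1 i1 = 1 / 2 ∧ T i1 i3 i3 = 0 ∧ T i1 i4 i4 = 7 / 4 ∧ T i1 i5 i5 = 3 / 4 ∧
    T i2 i2 i2 = 7 ∧ T i2 i3 i3 = 7 / 2 ∧ T i2 i4 i4 = 35 / 4 ∧ T i2 i5 i5 = 7 / 4 ∧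
    T i3 i4 i5 = 7 / 2 := by
  obtain ⟨s1, s2, s3, s4, s5⟩ := h.sum_eq_simplified
  obtain ⟨c3, f3, -, g3⟩ := h.exists_factor_simplified i3 (by decide) (by decide)
  obtain ⟨c4, f4, p4, q4⟩ := h.exists_factor_simplified i4 (by decide) (by decide)
  have n3 := h.dim_eq_one i3 (by decide) (by decide) h133
  have n4 := h.dim_eq_one i4 (by decide) (by decide)
  have t111 := h.nonneg i1 i1 i1
  have t144 := h.nonneg i1 i4 i4
  have t155 := h.nonneg i1 i5 i5
  have t222 := h.nonneg i2 i2 i2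
  have t244 := h.nonneg i2 i4 i4
  have t255 := h.nonneg i2 i5 i5
  rw [d1, d2, d3, d4, d5] at *
  push_cast at *
  have g3 := g3.resolve_left fun h0 => by simpa using n3 h0
  rcases eq_or_ne (T i1 i4 i4) 0 with h144 | h144
  -- Trivial action of `k₁` on `m₂` would make `(255)` exceed the bound from the sum over `m₃`.
  · exfalso
    have q4 := q4.resolve_left fun h0 => by simpa using n4 h144 h0
    linarith
  · have p4 := p4.resolve_left h144
    rcases q4 with q4 | q4
    -- Trivial action of `k₂` on `m₂` would give `(111) = -11 c₄` and `(144) = 14 c₄`.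
    · exfalso
      apply h144
      linarith
    · refine ⟨?_, h133, ?_, ?_, ?_, ?_, ?_, ?_, ?_⟩ <;> linarith

lemma eq_of_dim_E8 (d1 : d i1 = 28) (d2 : d i2 = 28) (d3 : d i3 = 64) (d4 : d i4 = 64)
    (d5 : d i5 = 64) :
    T i1 i1 i1 = 28 / 5 ∧ T i2 i2 i2 = 28 / 5 ∧ T i3 i4 i5 = 256 / 15 ∧
    T i1 i3 i3 = 112 / 15 ∧ T i1 i4 i4 = 112 / 15 ∧ T i1 i5 i5 = 112 / 15 ∧
    T i2 i3 i3 = 112 / 15 ∧ T i2 i4 i4 = 112 / 15 ∧ T i2 i5 i5 = 112 / 15 := by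
  obtain ⟨s1, s2, s3, s4, s5⟩ := h.sum_eq_simplified
  obtain ⟨c3, f3, p3, q3⟩ := h.exists_factor_simplified i3 (by decide) (by decide)
  obtain ⟨c4, f4, p4, q4⟩ := h.exists_factor_simplified i4 (by decide) (by decide)
  obtain ⟨c5, f5, p5, q5⟩ := h.exists_factor_simplified i5 (by decide) (by decide)
  have n3 := h.dim_eq_one i3 (by decide) (by decide)
  have t := h.nonneg
  rw [d1, d2, d3, d4, d5] at *
  push_cast at *
  have e34 : c4 = c3 := by linarith
  have e35 : c5 = c3 := by linarith
  rw [e34] at f4 p4 q4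
  rw [e35] at f5 p5 q5
  -- The common factor is positive: otherwise both ideals would act trivially on `m₁`.
  have hc : 0 < c3 := by
    have h1 := t i1 i3 i3
    have h2 := t i2 i3 i3
    by_contra hc
    have := n3 (by linarith) (by linarith)
    omega
  -- If an ideal acted trivially on `mᵢ`, then the other ideal `kₛ` would have `(sss) = -4 c₃`, and
  -- both together would give `c₃ = 0`.
  have key : ∀ i, 2 * T i1 i i + 2 * T i2 i i = c3 * 64 →
      (T i1 i i = 0 ∨ T i1 i1 i1 + T i1 i i = c3 * 28) →
      (T i2 i i = 0 ∨ T i2 i2 i2 + T i2 i i = c3 * 28) →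
      T i1 i1 i1 + T i1 i i = c3 * 28 ∧ T i2 i2 i2 + T i2 i i = c3 * 28 := by
    intro i f p q
    have a1 := t i1 i1 i1
    have a2 := t i2 i2 i2
    have b1 := t i1 i i
    have b2 := t i2 i i
    rcases p with p | p <;> rcases q with q | q
    · exfalso; linarith
    · exfalso; linarith
    · exfalso; linarith
    · exact ⟨p, q⟩
  obtain ⟨p3, q3⟩ := key i3 f3 p3 q3
  obtain ⟨p4, q4⟩ := key i4 f4 p4 q4
  obtain ⟨p5, q5⟩ := key i5 f5 p5 q5
  refine ⟨?_, ?_, ?_, ?_, ?_, ?_, ?_, ?_, ?_⟩ <;> linarith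

end TripleRelations

/-! ### The two decompositions -/

section Types

open Module

variable {g : Type*} [LieRing g] [LieAlgebra ℝ g]
  {k k₁ k₂ : LieSubalgebra ℝ g} {m₁ m₂ m₃ : Submodule ℝ g} {d : Idx → ℕ}
  {e : ∀ i, Basis (Fin (d i)) ℝ (summand k₁ k₂ m₁ m₂ m₃ i)}

lemma finrank_eq_sum_dim (he : IsAdaptedOrthonormal e)
    (hV : ∀ i j, i ≠ j → ∀ x ∈ summand k₁ k₂ m₁ m₂ m₃ i, ∀ y ∈ summand k₁ k₂ m₁ m₂ m₃ j,
      negKilling g x y = 0)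
    (hw : IsGeneralizedWallach k ![m₁, m₂, m₃]) (hi : IsSumOfIdeals k k₁ k₂) :
    finrank ℝ g = d i1 + (d i2 + (d i3 + (d i4 + d i5))) := by
  have h := finrank_biSup_eq_sum he hV Finset.univ
  have htop : ⨆ j ∈ Finset.univ, summand k₁ k₂ m₁ m₂ m₃ j = ⊤ := by
    rw [← iSup_summand_eq_top hw hi]; simp only [Finset.mem_univ, iSup_pos]
  rwa [Idx.sum_univ, htop, finrank_top] at h

lemma IsCompactSubalgebraOfType.finrank_eq [FiniteDimensional ℝ g] {n : ℕ} [NeZero n]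
    {A : Matrix (Fin n) (Fin n) ℤ}
    {W : Submodule ℝ g} (hW : IsCompactSubalgebraOfType A W) {h m : ℕ}
    (hA : RootCount.HasPositiveRoots A h m) : finrank ℝ W = n + 2 * m := by
  obtain ⟨b, rfl, hb⟩ := hW
  exact hb.finrank_eq hA

lemma finrank_isotropy_sup_eq (he : IsAdaptedOrthonormal e)
    (hV : ∀ i j, i ≠ j → ∀ x ∈ summand k₁ k₂ m₁ m₂ m₃ i, ∀ y ∈ summand k₁ k₂ m₁ m₂ m₃ j,
      negKilling g x y = 0) (hi : IsSumOfIdeals k k₁ k₂) (i : Idx) (h1 : i ≠ i1) (h2 : i ≠ i2) :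
    finrank ℝ (k.toSubmodule ⊔ summand k₁ k₂ m₁ m₂ m₃ i : Submodule ℝ g) =
      d i1 + (d i2 + d i) := by
  have := finrank_biSup_eq_sum he hV {i1, i2, i}
  rw [Finset.sum_insert (by simp [h1.symm]), Finset.sum_insert (by simp [h2.symm]),
    Finset.sum_singleton] at this
  rw [← this, ← hi.sup_eq, Finset.iSup_insert, Finset.iSup_insert, Finset.iSup_singleton, sup_assoc]
  rfl

lemma dim_eq_finrank (e : ∀ i, Basis (Fin (d i)) ℝ (summand k₁ k₂ m₁ m₂ m₃ i)) (i : Idx) :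
    d i = finrank ℝ (summand k₁ k₂ m₁ m₂ m₃ i) := by
  rw [finrank_eq_card_basis (e i), Fintype.card_fin]

/-- The ideal `k₁` acts trivially on `m₁` if `k₂ ⊕ m₁` is a subalgebra: then `[m₁, m₁]` lies in
`k₂`, hence is orthogonal to `k₁`. -/
lemma triple_one_three_three_eq_zero (he : IsAdaptedOrthonormal e)
    (hV : ∀ i j, i ≠ j → ∀ x ∈ summand k₁ k₂ m₁ m₂ m₃ i, ∀ y ∈ summand k₁ k₂ m₁ m₂ m₃ j,
      negKilling g x y = 0)
    (hw : IsGeneralizedWallach k ![m₁, m₂, m₃]) (hi : IsSumOfIdeals k k₁ k₂)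
    {b : LieSubalgebra ℝ g} (hb : b.toSubmodule = k₂.toSubmodule ⊔ m₁) :
    triple e i1 i3 i3 = 0 := by
  refine triple_eq_zero e fun x hx y hy z hz => ?_
  have hyb : ∀ y ∈ m₁, y ∈ b := fun y hy => by
    have : y ∈ b.toSubmodule := hb ▸ Submodule.mem_sup_right hy
    exact this
  have hyz : ⁅y, z⁆ ∈ b.toSubmodule := b.lie_mem (hyb y hy) (hyb z hz)
  rw [hb] at hyz
  obtain ⟨v, hv, w, hw', hvw⟩ := Submodule.mem_sup.1 hyz
  have hwk : w ∈ k := by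
    rw [← add_sub_cancel_left v w, hvw]
    exact k.sub_mem (hw.lie_self 0 y hy z hz) (hi.le_right hv)
  have hw0 : w = 0 := eq_zero_of_forall_negKilling_eq_zero (e i3) (he i3) hw'
    fun u hu => hw.orthogonal_k 0 w hwk u hu
  rw [negKilling_lie, ← hvw, hw0, add_zero]
  exact hV i1 i2 (by decide) x hx v hv

end Types

theorem lemma3p2 {g : Type*} [LieRing g] [LieAlgebra ℝ g] [FiniteDimensional ℝ g]
    (k k₁ k₂ : LieSubalgebra ℝ g) (m₁ m₂ m₃ : Submodule ℝ g) (d : Idx → ℕ)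
    (e : ∀ i, Module.Basis (Fin (d i)) ℝ (summand k₁ k₂ m₁ m₂ m₃ i))
    (he : IsAdaptedOrthonormal e) :
    (IsE6III k k₁ k₂ m₁ m₂ m₃ →
      triple e i1 i1 i1 = 1 / 2 ∧ triple e i1 i3 i3 = 0 ∧
      triple e i1 i4 i4 = 7 / 4 ∧ triple e i1 i5 i5 = 3 / 4 ∧
      triple e i2 i2 i2 = 7 ∧ triple e i2 i3 i3 = 7 / 2 ∧
      triple e i2 i4 i4 = 35 / 4 ∧ triple e i2 i5 i5 = 7 / 4 ∧
      triple e i3 i4 i5 = 7 / 2 ∧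
      (∀ i j l, triple e i j l = triple e j i l ∧ triple e i j l = triple e i l j) ∧
      (∀ i j l, {i, j, l} ∉ listedTriples → triple e i j l = 0)) ∧
    (IsE8II k k₁ k₂ m₁ m₂ m₃ →
      triple e i1 i1 i1 = 28 / 5 ∧ triple e i2 i2 i2 = 28 / 5 ∧
      triple e i3 i4 i5 = 256 / 15 ∧
      triple e i1 i3 i3 = 112 / 15 ∧ triple e i1 i4 i4 = 112 / 15 ∧
      triple e i1 i5 i5 = 112 / 15 ∧ triple e i2 i3 i3 = 112 / 15 ∧
      triple e i2 i4 i4 = 112 / 15 ∧ triple e i2 i5 i5 = 112 / 15 ∧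
      (∀ i j l, triple e i j l = triple e j i l ∧ triple e i j l = triple e i l j) ∧
      (∀ i j l, {i, j, l} ∉ listedTriples → triple e i j l = 0)) := by
  refine ⟨fun h => ?_, fun h => ?_⟩
  · have hT := tripleRelations he h.wallach h.ideals h.type_k₁ h.type_k₂
      hasConnectedDiagram_A_one hasConnectedDiagram_C_three
    have hV := summand_orthogonal he h.wallach h.ideals h.type_k₁.eq_zero_of_central
    have d1 : d i1 = 3 := (dim_eq_finrank e i1).trans
      (h.type_k₁.finrank_eq RootCount.hasPositiveRoots_A_one)
    have d2 : d i2 = 21 := (dim_eq_finrank e i2).trans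
      (h.type_k₂.finrank_eq RootCount.hasPositiveRoots_C_three)
    have dg := (finrank_eq_sum_dim he hV h.wallach h.ideals).symm.trans
      (h.type_g.finrank_eq RootCount.hasPositiveRoots_E_six)
    have dF := (finrank_isotropy_sup_eq he hV h.ideals i4 (by decide) (by decide)).symm.trans
      (h.type_F₄.finrank_eq RootCount.hasPositiveRoots_F_four)
    have dA : d i2 + d i3 = 5 + 2 * 15 := by
      have := finrank_biSup_eq_sum he hV {i2, i3}
      rw [Finset.iSup_insert, Finset.iSup_singleton, Finset.sum_insert (by decide),
        Finset.sum_singleton] at this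
      exact this.symm.trans (h.type_A₅.finrank_eq RootCount.hasPositiveRoots_A_five)
    obtain ⟨b, hb, -⟩ := h.type_A₅
    obtain ⟨t1, t2, t3, t4, t5, t6, t7, t8, t9⟩ := hT.eq_of_dim_E6 d1 d2 (by omega) (by omega)
      (by omega) (triple_one_three_three_eq_zero he hV h.wallach h.ideals hb)
    exact ⟨t1, t2, t3, t4, t5, t6, t7, t8, t9, fun i j l => ⟨hT.swap_left i j l, hT.swap_right i j l⟩,
      fun i j l hl => hT.eq_zero i j l (notMem_bracketIndices_of_notMem_listedTriples hl)⟩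
  · have hT := tripleRelations he h.wallach h.ideals h.type_k₁ h.type_k₂
      hasConnectedDiagram_D_four hasConnectedDiagram_D_four
    have hV := summand_orthogonal he h.wallach h.ideals h.type_k₁.eq_zero_of_central
    have d1 : d i1 = 28 := (dim_eq_finrank e i1).trans
      (h.type_k₁.finrank_eq RootCount.hasPositiveRoots_D_four)
    have d2 : d i2 = 28 := (dim_eq_finrank e i2).trans
      (h.type_k₂.finrank_eq RootCount.hasPositiveRoots_D_four)
    have dg := (finrank_eq_sum_dim he hV h.wallach h.ideals).symm.trans
      (h.type_g.finrank_eq RootCount.hasPositiveRoots_E_eight)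
    have dD := (finrank_isotropy_sup_eq he hV h.ideals i3 (by decide) (by decide)).symm.trans
      (h.type_D₈.finrank_eq RootCount.hasPositiveRoots_D_eight)
    have dD' := (finrank_isotropy_sup_eq he hV h.ideals i4 (by decide) (by decide)).symm.trans
      (h.type_D₈'.finrank_eq RootCount.hasPositiveRoots_D_eight)
    obtain ⟨t1, t2, t3, t4, t5, t6, t7, t8, t9⟩ := hT.eq_of_dim_E8 d1 d2 (by omega) (by omega)
      (by omega)
    exact ⟨t1, t2, t3, t4, t5, t6, t7, t8, t9, fun i j l => ⟨hT.swap_left i j l, hT.swap_right i j l⟩,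
      fun i j l hl => hT.eq_zero i j l (notMem_bracketIndices_of_notMem_listedTriples hl)⟩
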